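/- **Definitions.** A *$\nabla$-algebra* is a bounded lattice $\mathsf A=(A,\wedge,\vee,0,1)$ with operations $\nabla:A\to A$ and $\to:A\times A\to A$ such that, for all $a,b,c\in A$, $\nabla c\wedge a\le b$ if and only if $c\le a\to b$; put $\Box a=1\to a$. It is *distributive* $(D)$ if $\mathsf A$ is distributive, *normal* $(N)$ if $\nabla 1=1$ and $\nabla(a\wedge b)=\nabla a\wedge\nabla b$ for all $a,b$, *faithful* $(Fa)$ if $\nabla$ is surjective, and *full* $(Fu)$ if $\Box$ is surjective. A *$\nabla$-algebra morphism* is a bounded lattice morphism preserving $\nabla$ and $\to$. For a set $C$ of these conditions, $\mathbf{Alg}_\nabla(C)$ is the category of all $\nabla$-algebras satisfying $C$ with all $\nabla$-algebra morphisms. An *explicitly Heyting* $\nabla$-algebra is a $\nabla$-algebra whose underlying lattice is a Heyting algebra, with the Heyting implication (in general different from $\to$) added to the structure; $\mathbf{Alg}^H_\nabla(C)$ is the category of explicitly Heyting $\nabla$-algebras satisfying $C$, with the $\nabla$-algebra morphisms that also preserve the Heyting implication. A *Priestley space* is a compact topological space $X$ with a partial order $\le$ such that whenever $x\not\le y$ there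 is a clopen upset $U$ with $x\in U$ and $y\notin U$; *Priestley maps* are the continuous order-preserving maps, and $\mathbf{Pries}$ is the resulting category. Write ${\uparrow}x=\{y : x\le y\}$ and ${\downarrow}U=\{x : \exists y\in U,\ x\le y\}$. An *Esakia space* is a Priestley space in which ${\downarrow}U$ is clopen for every clopen $U$; an *Esakia map* is a Priestley map $f$ between Esakia spaces with $f[{\uparrow}x]={\uparrow}f(x)$ for all $x$; $\mathbf{Esakia}$ is the resulting category. $\mathbf{Esakia}^{\mathbb Z}$ is the category of *reversible dynamic Esakia spaces*: its objects are pairs $(X,\pi)$ of an Esakia space $X$ and an isomorphism $\pi:X\to X$ in $\mathbf{Esakia}$, and its morphisms $(X,\pi)\to(Y,\rho)$ are the Esakia maps $f$ with $f\pi=\rho f$. A *generalized Esakia space* $(X,\le,\pi)$ is a Priestley space $(X,\le)$ with a Priestley map $\pi:X\to X$ such that ${\downarrow}\pi[U]$ is clopen for every clopen $U$. A *generalized Esakia map* $f:(X,\le_X,\pi_X)\to(Y,\le_Y,\pi_Y)$ is a Priestley map with $f\pi_X=\pi_Yf$ and $\pi_Y^{-1}({\uparrow}f(x))=f[\pi_X^{-1}({\uparrow}x)]$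 for all $x\in X$. These form the category $\mathbf{gEsakia}$. The category $\mathbf{gEsakia}^H$ has as objects the generalized Esakia spaces whose underlying Priestley space is an Esakia space, and as morphisms the generalized Esakia maps that are also Esakia maps. The subscripts $rm$ and $e$ denote the full subcategories of those objects for which $\pi$ is a regular monomorphism, respectively an epimorphism, in $\mathbf{Pries}$. **Statement.** There are the following equivalences of categories: * $\mathbf{Alg}_{\nabla}(D,N)\simeq \mathbf{gEsakia}^{op}$ and $\mathbf{Alg}^H_{\nabla}(D,N)\simeq(\mathbf{gEsakia}^H)^{op}$; * $\mathbf{Alg}_{\nabla}(D,N,Fa)\simeq \mathbf{gEsakia}_{rm}^{op}$ and $\mathbf{Alg}^H_{\nabla}(D,N,Fa)\simeq(\mathbf{gEsakia}^H_{rm})^{op}$; * $\mathbf{Alg}_{\nabla}(D,N,Fu)\simeq \mathbf{gEsakia}_{e}^{op}$ and $\mathbf{Alg}^H_{\nabla}(D,N,Fu)\simeq(\mathbf{gEsakia}^H_{e})^{op}$; * $\mathbf{Alg}^H_{\nabla}(D,N,Fa,Fu)\simeq(\mathbf{Esakia}^{\mathbb Z})^{op}$. -/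

import Mathlib

open CategoryTheory

universe u

/-! ### `∇`-algebras -/

/-- A `∇`-algebra structure on a bounded lattice `A`: operations `∇` and `→` such that
`∇ c ⊓ a ≤ b` if and only if `c ≤ a → b`. -/
class NablaAlgebra (A : Type u) [Lattice A] [BoundedOrder A] where
  /-- The operation `∇`. -/
  nabla : A → A
  /-- The operation `→`, which in general is not a Heyting implication. -/
  imp : A → A → A
  /-- The adjunction between `∇ (-) ⊓ a` and `a → (-)`. -/
  nabla_inf_le_iff : ∀ a b c : A, nabla c ⊓ a ≤ b ↔ c ≤ imp a b

/-- The operation `□ a = 1 → a`. -/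
def NablaAlgebra.box {A : Type u} [Lattice A] [BoundedOrder A] [NablaAlgebra A] (a : A) : A :=
  NablaAlgebra.imp ⊤ a

/-- The names of the conditions on `∇`-algebras. -/
inductive NablaCond : Type
  /-- distributive -/
  | D
  /-- normal -/
  | N
  /-- faithful -/
  | Fa
  /-- full -/
  | Fu

/-- The `∇`-algebra `A` satisfies the given condition. -/
def NablaCond.Holds (A : Type u) [Lattice A] [BoundedOrder A] [NablaAlgebra A] :
    NablaCond → Prop
  | .D => ∀ a b c : A, a ⊓ (b ⊔ c) = (a ⊓ b) ⊔ (a ⊓ c)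
  | .N => NablaAlgebra.nabla (⊤ : A) = ⊤ ∧
      ∀ a b : A, NablaAlgebra.nabla (a ⊓ b) = NablaAlgebra.nabla a ⊓ NablaAlgebra.nabla b
  | .Fa => Function.Surjective (NablaAlgebra.nabla : A → A)
  | .Fu => Function.Surjective (NablaAlgebra.box : A → A)

/-- A `∇`-algebra morphism: a bounded lattice morphism preserving `∇` and `→`. -/
@[ext]
structure NablaHom (A B : Type u) [Lattice A] [BoundedOrder A] [NablaAlgebra A]
    [Lattice B] [BoundedOrder B] [NablaAlgebra B] where
  /-- The underlying bounded lattice morphism. -/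
  toLatHom : BoundedLatticeHom A B
  map_nabla : ∀ a : A,
    toLatHom (NablaAlgebra.nabla a) = NablaAlgebra.nabla (toLatHom a)
  map_imp : ∀ a b : A,
    toLatHom (NablaAlgebra.imp a b) = NablaAlgebra.imp (toLatHom a) (toLatHom b)

/-- The identity morphism. -/
def NablaHom.id (A : Type u) [Lattice A] [BoundedOrder A] [NablaAlgebra A] : NablaHom A A where
  toLatHom := BoundedLatticeHom.id A
  map_nabla _ := rfl
  map_imp _ _ := rfl

/-- Composition (first `f`, then `g`). -/
def NablaHom.comp {A B C : Type u} [Lattice A] [BoundedOrder A] [NablaAlgebra A]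
    [Lattice B] [BoundedOrder B] [NablaAlgebra B] [Lattice C] [BoundedOrder C] [NablaAlgebra C]
    (f : NablaHom A B) (g : NablaHom B C) : NablaHom A C where
  toLatHom := g.toLatHom.comp f.toLatHom
  map_nabla a := by simp [f.map_nabla, g.map_nabla]
  map_imp a b := by simp [f.map_imp, g.map_imp]

/-- The type of (bundled) `∇`-algebras. -/
structure NablaAlg : Type (u + 1) where
  /-- The underlying set. -/
  carrier : Type u
  [lattice : Lattice carrier]
  [boundedOrder : BoundedOrder carrier]
  [nablaAlgebra : NablaAlgebra carrier]

attribute [instance] NablaAlg.lattice NablaAlg.boundedOrder NablaAlg.nablaAlgebra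

/-- The category of `∇`-algebras and `∇`-algebra morphisms. -/
instance NablaAlg.category : Category.{u} NablaAlg.{u} where
  Hom A B := NablaHom A.carrier B.carrier
  id A := NablaHom.id A.carrier
  comp f g := NablaHom.comp f g

/-- The category `Alg_∇(C)` of the `∇`-algebras satisfying all conditions in `C`, with all
`∇`-algebra morphisms. -/
abbrev AlgNabla (C : Set NablaCond) : Type (u + 1) :=
  ObjectProperty.FullSubcategory
    (fun A : NablaAlg.{u} => ∀ c ∈ C, NablaCond.Holds A.carrier c)

/-- The type of (bundled) explicitly Heyting `∇`-algebras: the Heyting implication `⇨` of the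
underlying Heyting algebra is part of the structure, besides `∇` and `→`. -/
structure HeytNablaAlg : Type (u + 1) where
  /-- The underlying set. -/
  carrier : Type u
  [heytingAlgebra : HeytingAlgebra carrier]
  [nablaAlgebra : NablaAlgebra carrier]

attribute [instance] HeytNablaAlg.heytingAlgebra HeytNablaAlg.nablaAlgebra

/-- A Heyting `∇`-algebra morphism: a `∇`-algebra morphism that also preserves the Heyting
implication. -/
@[ext]
structure HeytNablaAlg.Hom (A B : HeytNablaAlg.{u}) extends
    NablaHom A.carrier B.carrier where
  map_himp : ∀ a b : A.carrier, toLatHom (a ⇨ b) = toLatHom a ⇨ toLatHom b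

/-- The category of explicitly Heyting `∇`-algebras and Heyting `∇`-algebra morphisms. -/
instance HeytNablaAlg.category : Category.{u} HeytNablaAlg.{u} where
  Hom A B := HeytNablaAlg.Hom A B
  id A := { toNablaHom := NablaHom.id A.carrier, map_himp := fun _ _ => rfl }
  comp f g :=
    { toNablaHom := NablaHom.comp f.toNablaHom g.toNablaHom
      map_himp := fun a b => by simp [NablaHom.comp, f.map_himp, g.map_himp] }

/-- The category `Alg_∇^H(C)` of the explicitly Heyting `∇`-algebras satisfying all conditions
in `C`, with all Heyting `∇`-algebra morphisms. -/
abbrev AlgNablaH (C : Set NablaCond) : Type (u + 1) :=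
  ObjectProperty.FullSubcategory
    (fun A : HeytNablaAlg.{u} => ∀ c ∈ C, NablaCond.Holds A.carrier c)

/-! ### Priestley and Esakia spaces -/

/-- The type of (bundled) Priestley spaces: compact ordered spaces in which `x ≰ y` implies that
some clopen upset contains `x` and not `y`. -/
structure Pries : Type (u + 1) where
  /-- The underlying set. -/
  carrier : Type u
  [topology : TopologicalSpace carrier]
  [order : PartialOrder carrier]
  [compact : CompactSpace carrier]
  [priestley : PriestleySpace carrier]

attribute [instance] Pries.topology Pries.order Pries.compact Pries.priestley

/-- A Priestley map: a continuous order-preserving function. -/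
@[ext]
structure Pries.Hom (X Y : Pries.{u}) where
  /-- The underlying function. -/
  toFun : X.carrier → Y.carrier
  continuous : Continuous toFun
  monotone : Monotone toFun

/-- The category `Pries` of Priestley spaces and Priestley maps. -/
instance Pries.category : Category.{u} Pries.{u} where
  Hom X Y := Pries.Hom X Y
  id X := ⟨fun x => x, continuous_id, monotone_id⟩
  comp f g := ⟨fun x => g.toFun (f.toFun x), g.continuous.comp f.continuous,
    g.monotone.comp f.monotone⟩

/-- A Priestley space is an Esakia space if `↓ U` is clopen for every clopen `U`. -/
def Pries.IsEsakia (X : Pries.{u}) : Prop :=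
  ∀ U : Set X.carrier, IsClopen U → IsClopen (lowerClosure U : Set X.carrier)

/-- The condition `f[↑ x] = ↑ f(x)`, for all `x`, on a Priestley map `f`; between Esakia spaces it
says that `f` is an Esakia map. -/
def Pries.Hom.IsEsakiaMap {X Y : Pries.{u}} (f : Pries.Hom X Y) : Prop :=
  ∀ x : X.carrier, f.toFun '' Set.Ici x = Set.Ici (f.toFun x)

theorem Pries.isEsakiaMap_id (X : Pries.{u}) : Pries.Hom.IsEsakiaMap (𝟙 X) :=
  fun _ => Set.image_id _

theorem Pries.isEsakiaMap_comp {X Y Z : Pries.{u}} {f : X ⟶ Y} {g : Y ⟶ Z}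
    (hf : Pries.Hom.IsEsakiaMap f) (hg : Pries.Hom.IsEsakiaMap g) :
    Pries.Hom.IsEsakiaMap (f ≫ g) := fun x => by
  have h : (f ≫ g).toFun = g.toFun ∘ f.toFun := rfl
  rw [h, Set.image_comp, hf x, hg]
  rfl

/-- The type of (bundled) Esakia spaces. -/
structure Esakia : Type (u + 1) where
  /-- The underlying Priestley space. -/
  toPries : Pries.{u}
  isEsakia : toPries.IsEsakia

/-- An Esakia map between Esakia spaces. -/
@[ext]
structure Esakia.Hom (X Y : Esakia.{u}) where
  /-- The underlying Priestley map. -/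
  hom : X.toPries ⟶ Y.toPries
  isEsakiaMap : Pries.Hom.IsEsakiaMap hom

/-- The category `Esakia` of Esakia spaces and Esakia maps. -/
instance Esakia.category : Category.{u} Esakia.{u} where
  Hom X Y := Esakia.Hom X Y
  id X := ⟨𝟙 X.toPries, Pries.isEsakiaMap_id _⟩
  comp f g := ⟨f.hom ≫ g.hom, Pries.isEsakiaMap_comp f.isEsakiaMap g.isEsakiaMap⟩

/-! ### Dynamic objects -/

/-- A dynamic object in a category `𝒞`: an object together with an endomorphism. -/
structure DynObj (𝒞 : Type (u + 1)) [Category.{u} 𝒞] : Type (u + 1) where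
  /-- The space of the dynamic object. -/
  space : 𝒞
  /-- The dynamism of the dynamic object. -/
  dyn : space ⟶ space

/-- A morphism of dynamic objects: a morphism commuting with the dynamisms. -/
@[ext]
structure DynObj.Hom {𝒞 : Type (u + 1)} [Category.{u} 𝒞] (A B : DynObj 𝒞) where
  /-- The underlying morphism. -/
  hom : A.space ⟶ B.space
  comm : A.dyn ≫ hom = hom ≫ B.dyn

/-- The category of dynamic objects in `𝒞`. -/
instance DynObj.category (𝒞 : Type (u + 1)) [Category.{u} 𝒞] : Category.{u} (DynObj 𝒞) where
  Hom A B := DynObj.Hom A B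
  id A := ⟨𝟙 A.space, by simp⟩
  comp f g := ⟨f.hom ≫ g.hom, by rw [← Category.assoc, f.comm, Category.assoc, g.comm,
    Category.assoc]⟩

/-- The full subcategory of reversible dynamic objects in `𝒞`: those whose dynamism is an
isomorphism of `𝒞`. -/
abbrev RevDynObj (𝒞 : Type (u + 1)) [Category.{u} 𝒞] : Type (u + 1) :=
  ObjectProperty.FullSubcategory (fun A : DynObj 𝒞 => IsIso A.dyn)

/-! ### Generalized Esakia spaces -/

/-- The type of (bundled) generalized Esakia spaces `(X, ≤, π)`: a dynamic Priestley space such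
that `↓ π[U]` is clopen for every clopen `U`. -/
structure GEsakia : Type (u + 1) where
  /-- The underlying dynamic Priestley space. -/
  toDyn : DynObj Pries.{u}
  isClopen_lowerClosure_image : ∀ U : Set toDyn.space.carrier, IsClopen U →
    IsClopen (lowerClosure (toDyn.dyn.toFun '' U) : Set toDyn.space.carrier)

/-- A generalized Esakia map `f : (X, ≤, π) → (Y, ≤, ρ)`: a Priestley map that commutes with the
dynamisms and satisfies `ρ⁻¹(↑ f(x)) = f[π⁻¹(↑ x)]` for all `x`. -/
@[ext]
structure GEsakia.Hom (X Y : GEsakia.{u}) extends DynObj.Hom X.toDyn Y.toDyn where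
  preimage_Ici : ∀ x : X.toDyn.space.carrier,
    Y.toDyn.dyn.toFun ⁻¹' Set.Ici (hom.toFun x) =
      hom.toFun '' (X.toDyn.dyn.toFun ⁻¹' Set.Ici x)

/-- The identity generalized Esakia map. -/
def GEsakia.Hom.id (X : GEsakia.{u}) : GEsakia.Hom X X where
  hom := 𝟙 X.toDyn.space
  comm := by simp
  preimage_Ici _ := (Set.image_id _).symm

/-- Composition of generalized Esakia maps (first `f`, then `g`). -/
def GEsakia.Hom.comp {X Y Z : GEsakia.{u}} (f : GEsakia.Hom X Y) (g : GEsakia.Hom Y Z) :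
    GEsakia.Hom X Z where
  hom := f.hom ≫ g.hom
  comm := by rw [← Category.assoc, f.comm, Category.assoc, g.comm, Category.assoc]
  preimage_Ici x := by
    have h := g.preimage_Ici (f.hom.toFun x)
    rw [f.preimage_Ici x, ← Set.image_comp] at h
    exact h

/-- The category `gEsakia` of generalized Esakia spaces and generalized Esakia maps. -/
instance GEsakia.category : Category.{u} GEsakia.{u} where
  Hom X Y := GEsakia.Hom X Y
  id X := GEsakia.Hom.id X
  comp f g := GEsakia.Hom.comp f g
  id_comp _ := rfl
  comp_id _ := rfl
  assoc _ _ _ := rfl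

/-- The names of the conditions on generalized Esakia spaces. -/
inductive GEsakiaCond : Type
  /-- regular monic -/
  | rm
  /-- epic -/
  | e

/-- The generalized Esakia space `X` satisfies the given condition: its dynamism is a regular
monomorphism, respectively an epimorphism, in the category of Priestley spaces. -/
def GEsakiaCond.Holds (X : GEsakia.{u}) : GEsakiaCond → Prop
  | .rm => IsRegularMono X.toDyn.dyn
  | .e => Epi X.toDyn.dyn

/-- The full subcategory `gEsakia_I` of the generalized Esakia spaces satisfying all conditions
in `I`. -/
abbrev GEsakiaSub (I : Set GEsakiaCond) : Type (u + 1) :=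
  ObjectProperty.FullSubcategory (fun X : GEsakia.{u} => ∀ c ∈ I, GEsakiaCond.Holds X c)

/-- The type of (bundled) Heyting generalized Esakia spaces: those whose underlying Priestley
space is an Esakia space. -/
structure GEsakiaH : Type (u + 1) where
  /-- The underlying generalized Esakia space. -/
  toGEsakia : GEsakia.{u}
  isEsakia : toGEsakia.toDyn.space.IsEsakia

/-- A Heyting generalized Esakia map: a generalized Esakia map that is also an Esakia map. -/
@[ext]
structure GEsakiaH.Hom (X Y : GEsakiaH.{u}) where
  /-- The underlying generalized Esakia map. -/
  toGHom : GEsakia.Hom X.toGEsakia Y.toGEsakia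
  isEsakiaMap : Pries.Hom.IsEsakiaMap toGHom.hom

/-- The category `gEsakia^H` of Heyting generalized Esakia spaces and Heyting generalized Esakia
maps. -/
instance GEsakiaH.category : Category.{u} GEsakiaH.{u} where
  Hom X Y := GEsakiaH.Hom X Y
  id X := ⟨GEsakia.Hom.id X.toGEsakia, Pries.isEsakiaMap_id _⟩
  comp f g := ⟨GEsakia.Hom.comp f.toGHom g.toGHom,
    Pries.isEsakiaMap_comp f.isEsakiaMap g.isEsakiaMap⟩

/-- The full subcategory `gEsakia_I^H` of the Heyting generalized Esakia spaces satisfying all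
conditions in `I`. -/
abbrev GEsakiaHSub (I : Set GEsakiaCond) : Type (u + 1) :=
  ObjectProperty.FullSubcategory
    (fun X : GEsakiaH.{u} => ∀ c ∈ I, GEsakiaCond.Holds X.toGEsakia c)

/-!
The equivalences are restrictions of Priestley duality. A generalized Esakia space `(X, π)` has the
dual algebra `GEsakia.clopUp X` of clopen upper sets, in which `∇` is the preimage under `π` and
`U → V` is the complement of `↓ π[U \ V]`; a generalized Esakia map has its preimage map as dual.
It is enough to see that this contravariant functor is fully faithful, to find its essential image,
and to translate the conditions.

*Full.* By compactness every bounded lattice homomorphism between lattices of clopen upper sets is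
the preimage map of a Priestley map `f` (`ClopenUpperSet.exists_eq_comap`). If it preserves `∇`, then
`f` commutes with the dynamisms; if it preserves `→`, then the closed sets `ρ⁻¹(↑ f(x))` and
`f[π⁻¹(↑ x)]` meet the same clopen sets, so they are equal (`preimage_Ici_eq_of_comap_residual`).

*Essential image.* In a distributive normal algebra `∇` is a bounded lattice endomorphism, since it
has the right adjoint `□`; it acts on the prime spectrum by inverse image, and this is the dynamism
of the dual space. By the prime ideal theorem, `a → b` belongs to a prime filter `p` if and only if
`b ∈ q` for all prime filters `q` with `p ⊆ ∇⁻¹ q` and `a ∈ q`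
(`LatticeSpec.residual_eq_true_iff`), which is the defining condition of generalized Esakia spaces
and shows that the unit `a ↦ {p | a ∈ p}` preserves `→`.

*Heyting implications.* The Heyting implication is the residual of the identity map, as `→` is the
residual of `∇`, and an Esakia map satisfies the condition on generalized Esakia maps for the
identity dynamisms. So the same lemmas with `π = id` give the Heyting versions.

*Conditions.* Surjectivity of `∇` means that `π` reflects the order, and surjectivity of `□` means
that `∇` is injective, that is, that `π` is surjective. In `Pries` the regular monomorphisms are the
order-reflecting maps and the epimorphisms are the surjections, because every closed subset is the
equalizer of two Priestley maps (`Pries.exists_eq_iff_mem`). A map with both properties is an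
isomorphism of Esakia spaces, and for such dynamisms the condition on generalized Esakia maps follows
from the one on Esakia maps; this gives the equivalence with reversible dynamic Esakia spaces.
-/

/-! ### Separation by clopen upper sets -/

section Separation

open Set Topology

/-- If a family of clopen sets closed under finite unions and finite intersections separates the
points of a compact set `K` from the points of a compact set `L`, then a single member of the family
separates `K` from `L`. -/
theorem exists_separating_of_isCompact {X : Type*} [TopologicalSpace X] {B : Set (Set X)}
    (hB : ∀ b ∈ B, IsClopen b) (hempty : ∅ ∈ B) (huniv : univ ∈ B)
    (hunion : ∀ b ∈ B, ∀ c ∈ B, b ∪ c ∈ B) (hinter : ∀ b ∈ B, ∀ c ∈ B, b ∩ c ∈ B)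
    {K L : Set X} (hK : IsCompact K) (hL : IsCompact L)
    (h : ∀ x ∈ K, ∀ y ∈ L, ∃ b ∈ B, x ∈ b ∧ y ∉ b) :
    ∃ b ∈ B, K ⊆ b ∧ Disjoint b L := by
  have key : ∀ x ∈ K, ∃ b ∈ B, x ∈ b ∧ Disjoint b L := by
    intro x hx
    refine hL.induction_on (p := fun T => ∃ b ∈ B, x ∈ b ∧ Disjoint b T)
      ⟨univ, huniv, mem_univ x, disjoint_empty _⟩ ?_ ?_ ?_
    · rintro s t hst ⟨b, hb, hxb, hd⟩
      exact ⟨b, hb, hxb, hd.mono_right hst⟩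
    · rintro s t ⟨b, hb, hxb, hd⟩ ⟨c, hc, hxc, hd'⟩
      exact ⟨b ∩ c, hinter b hb c hc, ⟨hxb, hxc⟩, disjoint_union_right.2
        ⟨hd.mono_left inter_subset_left, hd'.mono_left inter_subset_right⟩⟩
    · intro y hy
      obtain ⟨b, hb, hxb, hyb⟩ := h x hx y hy
      exact ⟨bᶜ, mem_nhdsWithin_of_mem_nhds ((hB b hb).compl.isOpen.mem_nhds hyb), b, hb, hxb,
        disjoint_compl_right⟩
  refine hK.induction_on (p := fun T => ∃ b ∈ B, T ⊆ b ∧ Disjoint b L)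
    ⟨∅, hempty, subset_rfl, empty_disjoint _⟩ ?_ ?_ ?_
  · rintro s t hst ⟨b, hb, htb, hd⟩
    exact ⟨b, hb, hst.trans htb, hd⟩
  · rintro s t ⟨b, hb, hsb, hd⟩ ⟨c, hc, htc, hd'⟩
    exact ⟨b ∪ c, hunion b hb c hc, union_subset_union hsb htc, disjoint_union_left.2 ⟨hd, hd'⟩⟩
  · intro x hx
    obtain ⟨b, hb, hxb, hd⟩ := key x hx
    exact ⟨b, mem_nhdsWithin_of_mem_nhds ((hB b hb).isOpen.mem_nhds hxb), b, hb, subset_rfl, hd⟩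

variable {X : Type*} [TopologicalSpace X] [PartialOrder X]

theorem ClopenUpperSet.eq_of_mem_iff {U V : ClopenUpperSet X} (h : ∀ x, x ∈ U ↔ x ∈ V) : U = V :=
  SetLike.ext h

theorem ClopenUpperSet.mem_congr {U V : ClopenUpperSet X} (h : U = V) (x : X) :
    x ∈ U ↔ x ∈ V := by rw [h]

theorem ClopenUpperSet.mem_top (x : X) : x ∈ (⊤ : ClopenUpperSet X) := mem_univ x

theorem ClopenUpperSet.notMem_bot (x : X) : x ∉ (⊥ : ClopenUpperSet X) := notMem_empty x

theorem ClopenUpperSet.isClopen_diff (U V : ClopenUpperSet X) :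
    IsClopen ((U : Set X) \ V) := U.isClopen.diff V.isClopen

variable [PriestleySpace X]

theorem ClopenUpperSet.exists_of_not_le {x y : X} (h : ¬ x ≤ y) :
    ∃ U : ClopenUpperSet X, x ∈ U ∧ y ∉ U := by
  obtain ⟨U, hU, hU', hx, hy⟩ := exists_isClopen_upper_of_not_le h
  exact ⟨⟨⟨U, hU⟩, hU'⟩, hx, hy⟩

theorem ClopenUpperSet.eq_of_forall_mem_iff {x y : X}
    (h : ∀ U : ClopenUpperSet X, x ∈ U ↔ y ∈ U) : x = y := by
  by_contra hne
  obtain hn | hn := Ne.not_le_or_not_ge hne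
  · obtain ⟨U, hx, hy⟩ := ClopenUpperSet.exists_of_not_le hn
    exact hy ((h U).1 hx)
  · obtain ⟨U, hy, hx⟩ := ClopenUpperSet.exists_of_not_le hn
    exact hx ((h U).2 hy)

theorem isClosed_Ici_of_priestleySpace (x : X) : IsClosed (Ici x) := by
  have h : Ici x = ⋂ U : {U : ClopenUpperSet X // x ∈ U}, (U.1 : Set X) := by
    ext y
    rw [mem_iInter]
    refine ⟨fun hy U => U.1.upper hy U.2, fun hy => ?_⟩
    by_contra hn
    obtain ⟨U, hx, hyU⟩ := ClopenUpperSet.exists_of_not_le hn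
    exact hyU (hy ⟨U, hx⟩)
  rw [h]
  exact isClosed_iInter fun U => U.1.isClopen.isClosed

theorem ClopenUpperSet.exists_separating {K L : Set X} (hK : IsCompact K) (hL : IsCompact L)
    (h : ∀ x ∈ K, ∀ y ∈ L, ¬ x ≤ y) :
    ∃ U : ClopenUpperSet X, K ⊆ U ∧ Disjoint (U : Set X) L := by
  obtain ⟨b, ⟨U, rfl⟩, hb⟩ := exists_separating_of_isCompact
    (B := range ((↑) : ClopenUpperSet X → Set X)) (by rintro _ ⟨U, rfl⟩; exact U.isClopen)
    ⟨⊥, rfl⟩ ⟨⊤, rfl⟩ (by rintro _ ⟨U, rfl⟩ _ ⟨V, rfl⟩; exact ⟨U ⊔ V, rfl⟩)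
    (by rintro _ ⟨U, rfl⟩ _ ⟨V, rfl⟩; exact ⟨U ⊓ V, rfl⟩) hK hL
    (fun x hx y hy => by
      obtain ⟨U, hU⟩ := ClopenUpperSet.exists_of_not_le (h x hx y hy)
      exact ⟨U, ⟨U, rfl⟩, hU⟩)
  exact ⟨U, hb⟩

/-- In a Priestley space, the differences of clopen upper sets form a basis. -/
theorem ClopenUpperSet.exists_diff_disjoint {y : X} {K : Set X} (hK : IsCompact K) (hy : y ∉ K) :
    ∃ U V : ClopenUpperSet X, y ∈ (U : Set X) \ V ∧ Disjoint ((U : Set X) \ V) K := by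
  refine hK.induction_on
    (p := fun T => ∃ U V : ClopenUpperSet X, y ∈ (U : Set X) \ V ∧ Disjoint ((U : Set X) \ V) T)
    ⟨⊤, ⊥, ⟨mem_univ y, notMem_empty y⟩, disjoint_empty _⟩ ?_ ?_ ?_
  · rintro s t hst ⟨U, V, hUV, hd⟩
    exact ⟨U, V, hUV, hd.mono_right hst⟩
  · rintro s t ⟨U, V, hUV, hd⟩ ⟨U', V', hUV', hd'⟩
    refine ⟨U ⊓ U', V ⊔ V', ⟨⟨hUV.1, hUV'.1⟩, fun h => h.elim hUV.2 hUV'.2⟩,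
      disjoint_union_right.2 ⟨hd.mono_left ?_, hd'.mono_left ?_⟩⟩
    · exact fun z hz => ⟨hz.1.1, fun h => hz.2 (Or.inl h)⟩
    · exact fun z hz => ⟨hz.1.2, fun h => hz.2 (Or.inr h)⟩
  · intro z hz
    obtain hn | hn := (show y ≠ z from fun h => hy (h ▸ hz)).not_le_or_not_ge
    · obtain ⟨U, hyU, hzU⟩ := ClopenUpperSet.exists_of_not_le hn
      exact ⟨(U : Set X)ᶜ, mem_nhdsWithin_of_mem_nhds (U.isClopen.compl.isOpen.mem_nhds hzU),
        U, ⊥, ⟨hyU, notMem_empty y⟩, disjoint_compl_right.mono_left sdiff_subset⟩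
    · obtain ⟨V, hzV, hyV⟩ := ClopenUpperSet.exists_of_not_le hn
      exact ⟨V, mem_nhdsWithin_of_mem_nhds (V.isClopen.isOpen.mem_nhds hzV),
        ⊤, V, ⟨mem_univ y, hyV⟩, disjoint_sdiff_left⟩

theorem isClopen_lowerClosure_image_of_diff [CompactSpace X] {π : X → X}
    (h : ∀ U V : ClopenUpperSet X, IsClopen (lowerClosure (π '' ((U : Set X) \ V)) : Set X))
    {W : Set X} (hW : IsClopen W) : IsClopen (lowerClosure (π '' W) : Set X) := by
  -- Compactness writes `W` as a finite union of differences of clopen upper sets.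
  obtain ⟨T, hWT, hTW, hT⟩ := hW.isClosed.isCompact.induction_on
    (p := fun S => ∃ T, S ⊆ T ∧ T ⊆ W ∧ IsClopen (lowerClosure (π '' T) : Set X))
    ⟨∅, subset_rfl, empty_subset _, by simp [isClopen_empty]⟩
    (by
      rintro s t hst ⟨T, htT, hT⟩
      exact ⟨T, hst.trans htT, hT⟩)
    (by
      rintro s t ⟨T, hsT, hTW, hT⟩ ⟨T', htT, hTW', hT'⟩
      refine ⟨T ∪ T', union_subset_union hsT htT, union_subset hTW hTW', ?_⟩
      rw [image_union, lowerClosure_union]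
      exact hT.union hT')
    (by
      intro x hx
      obtain ⟨U, V, hxUV, hd⟩ := ClopenUpperSet.exists_diff_disjoint
        hW.compl.isClosed.isCompact (fun hn => hn hx)
      exact ⟨_, mem_nhdsWithin_of_mem_nhds ((U.isClopen_diff V).isOpen.mem_nhds hxUV), _,
        subset_rfl, disjoint_compl_right_iff_subset.1 hd, h U V⟩)
  rwa [hTW.antisymm hWT] at hT

end Separation

/-! ### Maps between lattices of clopen upper sets -/

section Dual

open Set Topology

variable {X Y : Type*} [TopologicalSpace X] [PartialOrder X] [TopologicalSpace Y] [PartialOrder Y]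

/-- The bounded lattice homomorphism taking preimages under a continuous monotone map. -/
def ClopenUpperSet.comap (f : X → Y) (hf : Continuous f) (hm : Monotone f) :
    BoundedLatticeHom (ClopenUpperSet Y) (ClopenUpperSet X) where
  toFun U := ⟨⟨f ⁻¹' U, U.isClopen.preimage hf⟩, U.upper.preimage hm⟩
  map_sup' _ _ := rfl
  map_inf' _ _ := rfl
  map_top' := rfl
  map_bot' := rfl

theorem ClopenUpperSet.mem_comap {f : X → Y} {hf : Continuous f} {hm : Monotone f}
    {U : ClopenUpperSet Y} {x : X} : x ∈ ClopenUpperSet.comap f hf hm U ↔ f x ∈ U := Iff.rfl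

/-- The residual operation of the dynamism `π`: the complement of `↓ π[U \ V]`. For `π = id` this
is the Heyting implication of an Esakia space. -/
def ClopenUpperSet.residual (π : X → X)
    (hπ : ∀ W : Set X, IsClopen W → IsClopen (lowerClosure (π '' W) : Set X))
    (U V : ClopenUpperSet X) : ClopenUpperSet X :=
  ⟨⟨(lowerClosure (π '' ((U : Set X) \ V)) : Set X)ᶜ, (hπ _ (U.isClopen_diff V)).compl⟩,
    (lowerClosure _).lower.compl⟩

theorem ClopenUpperSet.mem_residual {π : X → X}
    {hπ : ∀ W : Set X, IsClopen W → IsClopen (lowerClosure (π '' W) : Set X)}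
    {U V : ClopenUpperSet X} {x : X} :
    x ∈ ClopenUpperSet.residual π hπ U V ↔ ∀ y, x ≤ π y → y ∈ U → y ∈ V := by
  change ¬ (x ∈ lowerClosure (π '' ((U : Set X) \ V))) ↔ _
  simp only [mem_lowerClosure, exists_mem_image, not_exists, not_and, mem_sdiff, SetLike.mem_coe]
  refine forall_congr' fun y => ?_
  tauto

theorem ClopenUpperSet.comap_inf_le_iff {π : X → X} (hc : Continuous π) (hm : Monotone π)
    (hπ : ∀ W : Set X, IsClopen W → IsClopen (lowerClosure (π '' W) : Set X))
    (U V W : ClopenUpperSet X) :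
    ClopenUpperSet.comap π hc hm W ⊓ U ≤ V ↔ W ≤ ClopenUpperSet.residual π hπ U V := by
  constructor
  · intro h w hw
    rw [ClopenUpperSet.mem_residual]
    intro y hy hyU
    exact h (show y ∈ ClopenUpperSet.comap π hc hm W ⊓ U from ⟨W.upper hy hw, hyU⟩)
  · intro h y hy
    exact ClopenUpperSet.mem_residual.1 (h hy.1) y le_rfl hy.2

/-- If taking preimages under an equivariant Priestley map `f` commutes with the residual operations,
then `f` satisfies the condition on generalized Esakia maps: a point `y` of `ρ⁻¹(↑ f(x))` outside the
closed set `f[π⁻¹(↑ x)]` would have a neighbourhood `U \ V` disjoint from that set, with `U` and `V`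
clopen upper sets; then `f(x)` would be in the residual of `U` and `V`, against `f(x) ≤ ρ(y)`. -/
theorem preimage_Ici_eq_of_comap_residual [CompactSpace X] [PriestleySpace X]
    [CompactSpace Y] [PriestleySpace Y] {π : X → X} {ρ : Y → Y} {f : X → Y}
    (hπc : Continuous π) (hf : Continuous f) (hm : Monotone f)
    (hπ : ∀ W : Set X, IsClopen W → IsClopen (lowerClosure (π '' W) : Set X))
    (hρ : ∀ W : Set Y, IsClopen W → IsClopen (lowerClosure (ρ '' W) : Set Y))
    (hcomm : ∀ x, f (π x) = ρ (f x))
    (h : ∀ U V, ClopenUpperSet.comap f hf hm (ClopenUpperSet.residual ρ hρ U V) =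
      ClopenUpperSet.residual π hπ (ClopenUpperSet.comap f hf hm U)
        (ClopenUpperSet.comap f hf hm V)) (x : X) :
    ρ ⁻¹' Ici (f x) = f '' (π ⁻¹' Ici x) := by
  apply Subset.antisymm
  · intro y hy
    by_contra hn
    obtain ⟨U, V, hyUV, hd⟩ := ClopenUpperSet.exists_diff_disjoint
      (((isClosed_Ici_of_priestleySpace x).preimage hπc).isCompact.image hf) hn
    have hx : x ∈ ClopenUpperSet.residual π hπ (ClopenUpperSet.comap f hf hm U)
        (ClopenUpperSet.comap f hf hm V) := by
      rw [ClopenUpperSet.mem_residual]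
      intro x' hx' hU
      by_contra hV
      exact disjoint_left.1 hd ⟨hU, hV⟩ ⟨x', hx', rfl⟩
    rw [← h] at hx
    exact hyUV.2 (ClopenUpperSet.mem_residual.1 (ClopenUpperSet.mem_comap.1 hx) y hy hyUV.1)
  · rintro _ ⟨x', hx', rfl⟩
    change f x ≤ ρ (f x')
    rw [← hcomm]
    exact hm hx'

theorem ClopenUpperSet.comap_residual {π : X → X} {ρ : Y → Y} {f : X → Y}
    {hf : Continuous f} {hm : Monotone f}
    {hπ : ∀ W : Set X, IsClopen W → IsClopen (lowerClosure (π '' W) : Set X)}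
    {hρ : ∀ W : Set Y, IsClopen W → IsClopen (lowerClosure (ρ '' W) : Set Y)}
    (h : ∀ x, ρ ⁻¹' Ici (f x) = f '' (π ⁻¹' Ici x)) (U V : ClopenUpperSet Y) :
    ClopenUpperSet.comap f hf hm (ClopenUpperSet.residual ρ hρ U V) =
      ClopenUpperSet.residual π hπ (ClopenUpperSet.comap f hf hm U)
        (ClopenUpperSet.comap f hf hm V) := by
  apply SetLike.ext
  intro x
  rw [ClopenUpperSet.mem_comap, ClopenUpperSet.mem_residual, ClopenUpperSet.mem_residual]
  constructor
  · intro hx x' hx' hU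
    exact hx (f x') (show f x' ∈ ρ ⁻¹' Ici (f x) from h x ▸ ⟨x', hx', rfl⟩) hU
  · intro hx y hy hU
    obtain ⟨x', hx', rfl⟩ : y ∈ f '' (π ⁻¹' Ici x) := h x ▸ hy
    exact hx x' hx' hU

/-- Every bounded lattice homomorphism between lattices of clopen upper sets is induced by a
continuous monotone map. The image of `x` is found by compactness: it is the point whose clopen
upper neighbourhoods `U` are those with `x ∈ h U`. -/
theorem ClopenUpperSet.exists_eq_comap [CompactSpace Y] [PriestleySpace Y]
    (h : BoundedLatticeHom (ClopenUpperSet Y) (ClopenUpperSet X)) :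
    ∃ (f : X → Y) (hf : Continuous f) (hm : Monotone f), h = ClopenUpperSet.comap f hf hm := by
  have key : ∀ x : X, ∃ y : Y, ∀ U, y ∈ U ↔ x ∈ h U := by
    intro x
    by_contra! hcon
    obtain ⟨U, V, hU, hV, hUV⟩ := isCompact_univ.induction_on
      (p := fun T : Set Y => ∃ U V : ClopenUpperSet Y, x ∈ h U ∧ x ∉ h V ∧
        ∀ y ∈ T, y ∈ U → y ∈ V)
      ⟨⊤, ⊥, by rw [map_top]; exact ClopenUpperSet.mem_top x,
        by rw [map_bot]; exact ClopenUpperSet.notMem_bot x, by simp⟩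
      (by
        rintro s t hst ⟨U, V, hU, hV, hd⟩
        exact ⟨U, V, hU, hV, fun y hy => hd y (hst hy)⟩)
      (by
        rintro s t ⟨U, V, hU, hV, hd⟩ ⟨U', V', hU', hV', hd'⟩
        refine ⟨U ⊓ U', V ⊔ V', ?_, ?_, ?_⟩
        · rw [map_inf]; exact ⟨hU, hU'⟩
        · rw [map_sup]; exact fun hn => hn.elim hV hV'
        · rintro y (hy | hy) hyU
          · exact Or.inl (hd y hy hyU.1)
          · exact Or.inr (hd' y hy hyU.2))
      (by
        intro y _
        obtain ⟨U, ⟨hyU, hxU⟩ | ⟨hyU, hxU⟩⟩ := hcon y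
        · exact ⟨U, mem_nhdsWithin_of_mem_nhds (U.isClopen.isOpen.mem_nhds hyU), ⊤, U,
            by rw [map_top]; exact ClopenUpperSet.mem_top x, hxU, fun _ hy _ => hy⟩
        · exact ⟨(U : Set Y)ᶜ,
            mem_nhdsWithin_of_mem_nhds (U.isClopen.compl.isOpen.mem_nhds hyU), U, ⊥, hxU,
            by rw [map_bot]; exact ClopenUpperSet.notMem_bot x, fun _ hy hyU => (hy hyU).elim⟩)
    have hle : U ≤ V := fun y hy => hUV y (mem_univ y) hy
    exact hV (OrderHomClass.mono h hle hU)
  choose f hf using key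
  have hpre : ∀ U : ClopenUpperSet Y, f ⁻¹' U = h U := fun U => Set.ext fun x => hf x U
  refine ⟨f, ?_, ?_, ?_⟩
  · rw [continuous_iff_continuousAt]
    intro x W hW
    change f ⁻¹' W ∈ 𝓝 x
    obtain ⟨O, hOW, hO, hxO⟩ := mem_nhds_iff.1 hW
    obtain ⟨U, V, hxUV, hd⟩ := ClopenUpperSet.exists_diff_disjoint (y := f x)
      hO.isClosed_compl.isCompact (fun hn => hn hxO)
    have hsub : f ⁻¹' ((U : Set Y) \ V) ⊆ f ⁻¹' W :=
      preimage_mono ((disjoint_compl_right_iff_subset.1 hd).trans hOW)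
    have hopen : IsOpen (f ⁻¹' ((U : Set Y) \ V)) := by
      rw [preimage_sdiff, hpre, hpre]
      exact ((h U).isClopen_diff (h V)).isOpen
    exact Filter.mem_of_superset (hopen.mem_nhds hxUV) hsub
  · intro x x' hx
    by_contra hn
    obtain ⟨U, hU, hU'⟩ := ClopenUpperSet.exists_of_not_le hn
    exact hU' ((hf x' U).2 ((h U).upper hx ((hf x U).1 hU)))
  · exact DFunLike.ext _ _ fun U => SetLike.ext fun x => (hf x U).symm

end Dual

/-! ### The prime spectrum of a bounded distributive lattice -/

section Spectrum

open Set Topology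

instance {I : Type*} : PriestleySpace (I → Bool) where
  priestley {x y} h := by
    obtain ⟨i, hi⟩ := not_forall.1 h
    refine ⟨(fun z : I → Bool => z i) ⁻¹' {true},
      (isClopen_discrete _).preimage (continuous_apply i), fun z w hzw hz => ?_, ?_, ?_⟩
    · exact Bool.le_iff_imp.1 (hzw i) hz
    · by_contra hx
      exact hi (Bool.le_iff_imp.2 fun h' => absurd h' hx)
    · exact fun hy => hi (Bool.le_iff_imp.2 fun _ => hy)

instance {X : Type*} [TopologicalSpace X] [PartialOrder X] [PriestleySpace X] (p : X → Prop) :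
    PriestleySpace {x // p x} where
  priestley {x y} h := by
    obtain ⟨U, hU, hU', hx, hy⟩ := exists_isClopen_upper_of_not_le (x := x.1) (y := y.1) h
    exact ⟨Subtype.val ⁻¹' U, hU.preimage continuous_subtype_val,
      hU'.preimage (Subtype.mono_coe p), hx, hy⟩

/-- The prime spectrum of a bounded lattice: a prime filter is encoded by its characteristic
function, a bounded lattice homomorphism to `Bool`. Order and topology are those of the power
`A → Bool`, so the order is inclusion of prime filters. -/
abbrev LatticeSpec (A : Type*) [Lattice A] [BoundedOrder A] : Type _ :=
  {p : A → Bool // p ⊤ = true ∧ p ⊥ = false ∧ (∀ a b, p (a ⊓ b) = (p a && p b)) ∧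
    ∀ a b, p (a ⊔ b) = (p a || p b)}

namespace LatticeSpec

variable {A : Type*} [Lattice A] [BoundedOrder A]

instance : CompactSpace (LatticeSpec A) := by
  have h (a : A) : Continuous fun p : A → Bool => p a := continuous_apply a
  have hand : Continuous fun z : Bool × Bool => (z.1 && z.2) := continuous_of_discreteTopology
  have hor : Continuous fun z : Bool × Bool => (z.1 || z.2) := continuous_of_discreteTopology
  suffices hcl : IsClosed {p : A → Bool | p ⊤ = true ∧ p ⊥ = false ∧
      (∀ a b, p (a ⊓ b) = (p a && p b)) ∧ ∀ a b, p (a ⊔ b) = (p a || p b)} from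
    isCompact_iff_compactSpace.1 hcl.isCompact
  simp only [ofPred_and, ofPred_forall]
  refine (isClosed_eq (h _) continuous_const).inter
    ((isClosed_eq (h _) continuous_const).inter (IsClosed.inter ?_ ?_))
  · exact isClosed_iInter fun a => isClosed_iInter fun b =>
      isClosed_eq (h _) (hand.comp ((h a).prodMk (h b)))
  · exact isClosed_iInter fun a => isClosed_iInter fun b =>
      isClosed_eq (h _) (hor.comp ((h a).prodMk (h b)))

/-- The clopen upper set of the prime filters containing `a`, as a bounded lattice homomorphism. -/
def unit (A : Type*) [Lattice A] [BoundedOrder A] :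
    BoundedLatticeHom A (ClopenUpperSet (LatticeSpec A)) where
  toFun a := ⟨⟨{p | p.1 a = true}, (isClopen_discrete {true}).preimage
      ((continuous_apply a).comp continuous_subtype_val)⟩,
    fun _ _ hpq hp => Bool.le_iff_imp.1 (hpq a) hp⟩
  map_sup' a b := SetLike.ext fun p => by
    change p.1 (a ⊔ b) = true ↔ p.1 a = true ∨ p.1 b = true
    rw [p.2.2.2.2, Bool.or_eq_true]
  map_inf' a b := SetLike.ext fun p => by
    change p.1 (a ⊓ b) = true ↔ p.1 a = true ∧ p.1 b = true
    rw [p.2.2.2.1, Bool.and_eq_true]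
  map_top' := SetLike.ext fun p => iff_of_true p.2.1 (ClopenUpperSet.mem_top p)
  map_bot' := SetLike.ext fun p => iff_of_false
    (show ¬ p.1 ⊥ = true by simp [p.2.2.1]) (ClopenUpperSet.notMem_bot p)

theorem mem_unit {a : A} {p : LatticeSpec A} : p ∈ unit A a ↔ p.1 a = true := Iff.rfl

/-- Compactness of the spectrum: a clopen upper set is separated from its complement by one
element of the lattice. -/
theorem unit_surjective : Function.Surjective (unit A) := by
  intro U
  obtain ⟨_, ⟨a, rfl⟩, hUa, hd⟩ := exists_separating_of_isCompact
    (B := range fun a => (unit A a : Set (LatticeSpec A)))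
    (by rintro _ ⟨a, rfl⟩; exact (unit A a).isClopen)
    ⟨⊥, by simp⟩ ⟨⊤, by simp⟩
    (by rintro _ ⟨a, rfl⟩ _ ⟨b, rfl⟩; exact ⟨a ⊔ b, by simp⟩)
    (by rintro _ ⟨a, rfl⟩ _ ⟨b, rfl⟩; exact ⟨a ⊓ b, by simp⟩)
    U.isClopen.isClosed.isCompact U.isClopen.compl.isClosed.isCompact
    (by
      intro p hp q hq
      obtain ⟨a, ha⟩ := not_forall.1 (fun hpq : p ≤ q => hq (U.upper hpq hp))
      refine ⟨_, ⟨a, rfl⟩, ?_, fun hqa => ha (Bool.le_iff_imp.2 fun _ => hqa)⟩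
      by_contra hpa
      exact ha (Bool.le_iff_imp.2 fun h => absurd h hpa))
  exact ⟨a, SetLike.coe_injective ((disjoint_compl_right_iff_subset.1 hd).antisymm hUa)⟩

/-- The prime filter theorem: a filter of a distributive lattice that does not contain `b` extends to
a prime filter that does not contain `b`. -/
theorem exists_of_notMem (hD : ∀ a b c : A, a ⊓ (b ⊔ c) = (a ⊓ b) ⊔ (a ⊓ c)) {F : Set A}
    (htop : ⊤ ∈ F) (hinf : ∀ a ∈ F, ∀ b ∈ F, a ⊓ b ∈ F) (hup : ∀ a b, a ≤ b → a ∈ F → b ∈ F)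
    {b : A} (hb : b ∉ F) :
    ∃ q : LatticeSpec A, (∀ a ∈ F, q.1 a = true) ∧ q.1 b = false := by
  let : DistribLattice A := DistribLattice.ofInfSupLe fun a b c => (hD a b c).le
  have hF : Order.IsPFilter F := Order.IsPFilter.of_def ⟨⊤, htop⟩
    (fun x hx y hy => ⟨x ⊓ y, hinf x hx y hy, inf_le_left, inf_le_right⟩)
    (fun {x y} hxy hx => hup x y hxy hx)
  have hdisj : Disjoint (hF.toPFilter : Set A) (Order.Ideal.principal b : Set A) :=
    disjoint_left.2 fun a ha hab => hb (hup a b hab ha)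
  obtain ⟨J, hJ, hbJ, hFJ⟩ := DistribLattice.prime_ideal_of_disjoint_filter_ideal hdisj
  classical
  refine ⟨⟨fun a => decide (a ∉ J), ?_, ?_, fun a c => ?_, fun a c => ?_⟩, fun a ha => ?_, ?_⟩
  · exact decide_eq_true hJ.toIsProper.top_notMem
  · exact decide_eq_false (not_not.2 J.bot_mem)
  · have h : a ⊓ c ∈ J ↔ a ∈ J ∨ c ∈ J := ⟨hJ.mem_or_mem, fun h => h.elim
      (J.lower inf_le_left) (J.lower inf_le_right)⟩
    rw [Bool.eq_iff_iff]
    simp only [decide_eq_true_eq, Bool.and_eq_true, h, not_or]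
  · have h : a ⊔ c ∈ J ↔ a ∈ J ∧ c ∈ J := Order.Ideal.sup_mem_iff
    rw [Bool.eq_iff_iff]
    simp only [decide_eq_true_eq, Bool.or_eq_true, h, not_and_or]
  · exact decide_eq_true (disjoint_left.1 hFJ ha)
  · exact decide_eq_false (not_not.2 (hbJ (le_refl b)))

theorem unit_injective (hD : ∀ a b c : A, a ⊓ (b ⊔ c) = (a ⊓ b) ⊔ (a ⊓ c)) :
    Function.Injective (unit A) := by
  have key : ∀ a b : A, unit A a ≤ unit A b → a ≤ b := by
    intro a b hab
    by_contra hn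
    obtain ⟨q, hq, hqb⟩ := exists_of_notMem hD (F := Ici a) (b := b) le_top
      (fun _ hx _ hy => le_inf hx hy) (fun _ _ hxy hx => le_trans hx hxy) hn
    have hb : q.1 b = true := hab (show q ∈ unit A a from hq a le_rfl)
    simp [hqb] at hb
  exact fun a b hab => (key a b hab.le).antisymm (key b a hab.ge)

/-- The map on prime spectra induced by a bounded lattice endomorphism. -/
def comap (j : BoundedLatticeHom A A) (p : LatticeSpec A) : LatticeSpec A :=
  ⟨fun a => p.1 (j a), by simp [p.2.1], by simp [p.2.2.1], by simp [p.2.2.2.1],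
    by simp [p.2.2.2.2]⟩

theorem continuous_comap (j : BoundedLatticeHom A A) : Continuous (comap j) :=
  Continuous.subtype_mk (f := fun (p : LatticeSpec A) (a : A) => p.1 (j a))
    (continuous_pi fun a => (continuous_apply (j a)).comp continuous_subtype_val) _

theorem monotone_comap (j : BoundedLatticeHom A A) : Monotone (comap j) :=
  fun _ _ hpq a => hpq (j a)

variable {j : BoundedLatticeHom A A} {r : A → A → A}

/-- Prime extension for the residual `r` of `j`. If `r a b` is not in `p`, then `b` is not in the
filter generated by `j[p]` and `a`, so a prime filter extends that filter and omits `b`. -/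
theorem residual_eq_true_iff (hD : ∀ a b c : A, a ⊓ (b ⊔ c) = (a ⊓ b) ⊔ (a ⊓ c))
    (hr : ∀ a b c, j c ⊓ a ≤ b ↔ c ≤ r a b) (p : LatticeSpec A) (a b : A) :
    p.1 (r a b) = true ↔ ∀ q : LatticeSpec A, p ≤ comap j q → q.1 a = true → q.1 b = true := by
  have hmono (q : LatticeSpec A) {x y : A} (hxy : x ≤ y) (hx : q.1 x = true) : q.1 y = true :=
    (OrderHomClass.mono (unit A) hxy : unit A x ≤ unit A y) hx
  have hand (q : LatticeSpec A) {x y : A} (hx : q.1 x = true) (hy : q.1 y = true) :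
      q.1 (x ⊓ y) = true := by rw [q.2.2.2.1, hx, hy, Bool.and_self]
  constructor
  · intro h q hpq ha
    have hj : q.1 (j (r a b)) = true := Bool.le_iff_imp.1 (hpq (r a b)) h
    exact hmono q ((hr a b _).2 le_rfl) (hand q hj ha)
  · intro h
    by_contra hp
    obtain ⟨q, hq, hqb⟩ := exists_of_notMem hD
      (F := {d | ∃ c, p.1 c = true ∧ j c ⊓ a ≤ d}) (b := b) ⟨⊤, p.2.1, le_top⟩
      (by
        rintro x ⟨c, hc, hcx⟩ y ⟨d, hd, hdy⟩
        refine ⟨c ⊓ d, hand p hc hd, ?_⟩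
        rw [map_inf]
        exact le_inf ((inf_le_inf_right a inf_le_left).trans hcx)
          ((inf_le_inf_right a inf_le_right).trans hdy))
      (by
        rintro x y hxy ⟨c, hc, hcx⟩
        exact ⟨c, hc, hcx.trans hxy⟩)
      (by
        rintro ⟨c, hc, hcb⟩
        exact hp (hmono p ((hr a b c).1 hcb) hc))
    have hb : q.1 b = true := h q
      (fun c => Bool.le_iff_imp.2 fun hc => hq _ ⟨c, hc, inf_le_left⟩)
      (hq a ⟨⊤, p.2.1, inf_le_right⟩)
    simp [hqb] at hb

theorem isClopen_lowerClosure_image_comap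
    (hD : ∀ a b c : A, a ⊓ (b ⊔ c) = (a ⊓ b) ⊔ (a ⊓ c))
    (hr : ∀ a b c, j c ⊓ a ≤ b ↔ c ≤ r a b) (W : Set (LatticeSpec A)) (hW : IsClopen W) :
    IsClopen (lowerClosure (comap j '' W) : Set (LatticeSpec A)) := by
  refine isClopen_lowerClosure_image_of_diff (fun U V => ?_) hW
  obtain ⟨a, rfl⟩ := unit_surjective U
  obtain ⟨b, rfl⟩ := unit_surjective V
  have h : (lowerClosure (comap j '' ((unit A a : Set (LatticeSpec A)) \ unit A b)) :
      Set (LatticeSpec A)) = (unit A (r a b) : Set (LatticeSpec A))ᶜ := by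
    ext p
    rw [mem_compl_iff, SetLike.mem_coe, SetLike.mem_coe, mem_unit, residual_eq_true_iff hD hr]
    simp only [mem_lowerClosure, exists_mem_image, mem_sdiff, SetLike.mem_coe, mem_unit]
    push Not
    refine exists_congr fun q => ?_
    tauto
  rw [h]
  exact (unit A (r a b)).isClopen.compl

theorem unit_residual (hD : ∀ a b c : A, a ⊓ (b ⊔ c) = (a ⊓ b) ⊔ (a ⊓ c))
    (hr : ∀ a b c, j c ⊓ a ≤ b ↔ c ≤ r a b)
    (hπ : ∀ W : Set (LatticeSpec A), IsClopen W →
      IsClopen (lowerClosure (comap j '' W) : Set (LatticeSpec A))) (a b : A) :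
    unit A (r a b) = ClopenUpperSet.residual (comap j) hπ (unit A a) (unit A b) :=
  SetLike.ext fun p => by
    rw [mem_unit, residual_eq_true_iff hD hr, ClopenUpperSet.mem_residual]
    rfl

end LatticeSpec

end Spectrum

/-! ### Regular monomorphisms and epimorphisms of Priestley spaces -/

section PriestleyCategory

open Set Topology Limits

/-- The Priestley space `I → Bool`. -/
def Pries.cube (I : Type u) : Pries.{u} where
  carrier := I → Bool

/-- The Priestley map to a cube given by a family of clopen upper sets. -/
noncomputable def Pries.toCube (Y : Pries.{u}) {I : Type u} (U : I → ClopenUpperSet Y.carrier) :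
    Y ⟶ Pries.cube I where
  toFun y i := (U i : Set Y.carrier).boolIndicator y
  continuous := continuous_pi fun i => (continuous_boolIndicator_iff_isClopen _).2 (U i).isClopen
  monotone y z hyz i := Bool.le_iff_imp.2 fun hy =>
    (mem_iff_boolIndicator _ z).1 ((U i).upper hyz ((mem_iff_boolIndicator _ y).2 hy))

/-- A closed subset of a Priestley space is the equalizer of two Priestley maps: take all the pairs
of clopen upper sets with the same trace on the subset. -/
theorem Pries.exists_eq_iff_mem (Y : Pries.{u}) {C : Set Y.carrier} (hC : IsClosed C) :
    ∃ (Z : Pries.{u}) (g h : Y ⟶ Z), ∀ y, g.toFun y = h.toFun y ↔ y ∈ C := by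
  let I := {P : ClopenUpperSet Y.carrier × ClopenUpperSet Y.carrier //
    ∀ y ∈ C, y ∈ P.1 ↔ y ∈ P.2}
  refine ⟨Pries.cube I, Y.toCube fun i : I => i.1.1, Y.toCube fun i : I => i.1.2, fun y => ?_⟩
  have hiff : (Y.toCube fun i : I => i.1.1).toFun y = (Y.toCube fun i : I => i.1.2).toFun y ↔
      ∀ i : I, y ∈ i.1.1 ↔ y ∈ i.1.2 := by
    refine funext_iff.trans (forall_congr' fun i => Bool.eq_iff_iff.trans ?_)
    exact iff_congr (mem_iff_boolIndicator (i.1.1 : Set Y.carrier) y).symm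
      (mem_iff_boolIndicator (i.1.2 : Set Y.carrier) y).symm
  rw [hiff]
  refine ⟨fun h => ?_, fun hy i => i.2 y hy⟩
  by_contra hy
  obtain ⟨U, V, hyUV, hd⟩ := ClopenUpperSet.exists_diff_disjoint hC.isCompact hy
  have hyV := (h ⟨(U, U ⊓ V), fun z hz => ⟨fun hU => ⟨hU, ?_⟩, fun hUV => hUV.1⟩⟩).1 hyUV.1
  · exact hyUV.2 hyV.2
  · by_contra hV
    exact disjoint_left.1 hd ⟨hU, hV⟩ hz

theorem Pries.hom_ext {X Y : Pries.{u}} {f g : X ⟶ Y} (h : ∀ x, f.toFun x = g.toFun x) : f = g :=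
  Pries.Hom.ext (funext h)

theorem Pries.epi_iff_surjective {X Y : Pries.{u}} (f : X ⟶ Y) :
    Epi f ↔ Function.Surjective f.toFun := by
  constructor
  · intro hf
    obtain ⟨Z, g, h, hgh⟩ := Y.exists_eq_iff_mem (isCompact_range f.continuous).isClosed
    have heq : g = h := (cancel_epi f).1 (Pries.hom_ext fun x => (hgh _).2 ⟨x, rfl⟩)
    exact fun y => (hgh y).1 (by rw [heq])
  · intro hf
    refine ⟨fun g h hgh => Pries.hom_ext fun y => ?_⟩
    obtain ⟨x, rfl⟩ := hf y
    exact congrFun (congrArg Pries.Hom.toFun hgh) x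

/-- The Priestley map from the two-element chain that picks out two comparable points. -/
def Pries.chain {Y : Pries.{u}} {y z : Y.carrier} (h : y ≤ z) : Pries.cube PUnit.{u + 1} ⟶ Y where
  toFun w := bif w PUnit.unit then z else y
  continuous := (continuous_of_discreteTopology (f := fun b : Bool => bif b then z else y)).comp
    (continuous_apply PUnit.unit)
  monotone w w' hw := by
    have hb := Bool.le_iff_imp.1 (hw PUnit.unit)
    cases hw0 : w PUnit.unit <;> cases hw1 : w' PUnit.unit <;> simp_all

theorem Pries.isRegularMono_iff {X Y : Pries.{u}} (f : X ⟶ Y) :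
    IsRegularMono f ↔ ∀ x y, f.toFun x ≤ f.toFun y → x ≤ y := by
  constructor
  · rintro ⟨⟨hf⟩⟩ x y hxy
    have := hf.mono
    have hinj : Function.Injective f.toFun := by
      intro a b hab
      have h : Pries.chain (le_refl a) = Pries.chain (le_refl b) := by
        apply (cancel_mono f).1
        refine Pries.hom_ext fun w => ?_
        change f.toFun (bif _ then a else a) = f.toFun (bif _ then b else b)
        rw [Bool.cond_self, Bool.cond_self, hab]
      exact congrFun (congrArg Pries.Hom.toFun h) fun _ => true
    -- The chain `f x ≤ f y` equalizes the pair that `f` equalizes, so it lifts along `f`.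
    have hw : Pries.chain hxy ≫ hf.left = Pries.chain hxy ≫ hf.right := by
      refine Pries.hom_ext fun w => ?_
      have he (a : X.carrier) : hf.left.toFun (f.toFun a) = hf.right.toFun (f.toFun a) :=
        congrFun (congrArg Pries.Hom.toFun hf.w) a
      change hf.left.toFun (bif w PUnit.unit then _ else _) =
        hf.right.toFun (bif w PUnit.unit then _ else _)
      cases w PUnit.unit
      · exact he x
      · exact he y
    obtain ⟨l, hl⟩ := RegularMono.lift' hf (Pries.chain hxy) hw
    have hl' (w) : f.toFun (l.toFun w) = (Pries.chain hxy).toFun w :=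
      congrFun (congrArg Pries.Hom.toFun hl) w
    have hx : l.toFun (fun _ => false) = x := hinj (hl' _)
    have hy : l.toFun (fun _ => true) = y := hinj (hl' _)
    rw [← hx, ← hy]
    exact l.monotone fun _ => Bool.false_le _
  · intro hf
    have hinj : Function.Injective f.toFun := fun a b hab =>
      (hf a b hab.le).antisymm (hf b a hab.ge)
    have hemb := f.continuous.isClosedEmbedding hinj
    obtain ⟨Z, g, h, hgh⟩ := Y.exists_eq_iff_mem hemb.isClosed_range
    have hw : f ≫ g = f ≫ h := Pries.hom_ext fun x => (hgh _).2 ⟨x, rfl⟩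
    refine ⟨⟨⟨Z, g, h, hw, Fork.IsLimit.ofExistsUnique fun s => ?_⟩⟩⟩
    have hs (w) : ∃ x, f.toFun x = s.ι.toFun w :=
      (hgh _).1 (congrFun (congrArg Pries.Hom.toFun s.condition) w)
    choose l hl using hs
    refine ⟨⟨l, ?_, ?_⟩, Pries.hom_ext hl, fun m hm => Pries.hom_ext fun w => hinj ?_⟩
    · rw [hemb.isInducing.continuous_iff, show f.toFun ∘ l = s.ι.toFun from funext hl]
      exact s.ι.continuous
    · intro a b hab
      apply hf
      rw [hl, hl]
      exact s.ι.monotone hab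
    · exact (congrFun (congrArg Pries.Hom.toFun hm) w).trans (hl w).symm

end PriestleyCategory

/-! ### The `∇`-algebra of a generalized Esakia space -/

section ClopUp

open Set

/-- The `∇`-algebra structure on the clopen upper sets of a generalized Esakia space: `∇` is the
preimage under the dynamism `π`, and `U → V` is the complement of `↓ π[U \ V]`. -/
@[reducible]
def GEsakia.nablaAlgebra (X : GEsakia.{u}) :
    NablaAlgebra (ClopenUpperSet X.toDyn.space.carrier) where
  nabla := ClopenUpperSet.comap X.toDyn.dyn.toFun X.toDyn.dyn.continuous X.toDyn.dyn.monotone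
  imp := ClopenUpperSet.residual X.toDyn.dyn.toFun X.isClopen_lowerClosure_image
  nabla_inf_le_iff := ClopenUpperSet.comap_inf_le_iff X.toDyn.dyn.continuous
    X.toDyn.dyn.monotone X.isClopen_lowerClosure_image

/-- The dual `∇`-algebra of a generalized Esakia space. -/
def GEsakia.clopUp (X : GEsakia.{u}) : NablaAlg.{u} where
  carrier := ClopenUpperSet X.toDyn.space.carrier
  nablaAlgebra := X.nablaAlgebra

/-- The dual `∇`-algebra morphism of a generalized Esakia map. -/
def GEsakia.Hom.clopUp {X Y : GEsakia.{u}} (f : GEsakia.Hom X Y) :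
    NablaHom Y.clopUp.carrier X.clopUp.carrier where
  toLatHom := ClopenUpperSet.comap f.hom.toFun f.hom.continuous f.hom.monotone
  map_nabla (U : ClopenUpperSet Y.toDyn.space.carrier) :=
    ClopenUpperSet.eq_of_mem_iff (X := X.toDyn.space.carrier) fun x => by
    have h : f.hom.toFun (X.toDyn.dyn.toFun x) = Y.toDyn.dyn.toFun (f.hom.toFun x) :=
      congrFun (congrArg Pries.Hom.toFun f.comm) x
    change Y.toDyn.dyn.toFun (f.hom.toFun x) ∈ U ↔ f.hom.toFun (X.toDyn.dyn.toFun x) ∈ U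
    rw [h]
  map_imp := ClopenUpperSet.comap_residual f.preimage_Ici

theorem GEsakia.Hom.exists_clopUp_eq {X Y : GEsakia.{u}}
    (h : NablaHom Y.clopUp.carrier X.clopUp.carrier) :
    ∃ f : GEsakia.Hom X Y, f.clopUp = h := by
  obtain ⟨f, hf, hm, hfh⟩ := ClopenUpperSet.exists_eq_comap
    (X := X.toDyn.space.carrier) (Y := Y.toDyn.space.carrier) h.toLatHom
  have hcomm (x) : f (X.toDyn.dyn.toFun x) = Y.toDyn.dyn.toFun (f x) := by
    refine ClopenUpperSet.eq_of_forall_mem_iff fun U => ?_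
    have hU := h.map_nabla U
    rw [hfh] at hU
    exact (ClopenUpperSet.mem_congr hU x).symm
  refine ⟨⟨⟨⟨f, hf, hm⟩, Pries.hom_ext hcomm⟩, ?_⟩, NablaHom.ext hfh.symm⟩
  refine preimage_Ici_eq_of_comap_residual X.toDyn.dyn.continuous hf hm
    X.isClopen_lowerClosure_image Y.isClopen_lowerClosure_image hcomm fun U V => ?_
  have hUV := h.map_imp U V
  rw [hfh] at hUV
  exact hUV

theorem GEsakia.Hom.clopUp_injective {X Y : GEsakia.{u}} :
    Function.Injective (GEsakia.Hom.clopUp : GEsakia.Hom X Y → _) := by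
  intro f g h
  have hfg : f.hom = g.hom := Pries.hom_ext fun x =>
    ClopenUpperSet.eq_of_forall_mem_iff fun U =>
      ClopenUpperSet.mem_congr (DFunLike.congr_fun (congrArg NablaHom.toLatHom h) U) x
  exact GEsakia.Hom.ext hfg

/-- The contravariant functor of clopen upper sets on generalized Esakia spaces. -/
def GEsakia.clopUpFunctor : GEsakia.{u}ᵒᵖ ⥤ NablaAlg.{u} where
  obj X := X.unop.clopUp
  map f := GEsakia.Hom.clopUp f.unop
  map_id _ := rfl
  map_comp _ _ := rfl

instance : GEsakia.clopUpFunctor.{u}.Full where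
  map_surjective h := by
    obtain ⟨f, hf⟩ := GEsakia.Hom.exists_clopUp_eq h
    exact ⟨Quiver.Hom.op f, hf⟩

instance : GEsakia.clopUpFunctor.{u}.Faithful where
  map_injective h := Quiver.Hom.unop_inj (GEsakia.Hom.clopUp_injective h)

theorem Pries.IsEsakia.isClopen_lowerClosure_image_id {X : Pries.{u}} (hX : X.IsEsakia)
    (W : Set X.carrier) (hW : IsClopen W) :
    IsClopen (lowerClosure (id '' W) : Set X.carrier) := by
  rw [image_id]
  exact hX W hW

/-- The Heyting algebra of clopen upper sets of an Esakia space; its implication is the residual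
of the identity map. -/
@[reducible]
def Pries.IsEsakia.heytingAlgebra {X : Pries.{u}} (hX : X.IsEsakia) :
    HeytingAlgebra (ClopenUpperSet X.carrier) where
  toLattice := inferInstance
  __ := (inferInstance : BoundedOrder (ClopenUpperSet X.carrier))
  himp := ClopenUpperSet.residual id hX.isClopen_lowerClosure_image_id
  le_himp_iff U V W := (ClopenUpperSet.comap_inf_le_iff continuous_id monotone_id
    hX.isClopen_lowerClosure_image_id V W U).symm
  compl U := ClopenUpperSet.residual id hX.isClopen_lowerClosure_image_id U ⊥
  himp_bot _ := rfl

/-- The dual explicitly Heyting `∇`-algebra of a Heyting generalized Esakia space. -/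
def GEsakiaH.clopUp (X : GEsakiaH.{u}) : HeytNablaAlg.{u} where
  carrier := ClopenUpperSet X.toGEsakia.toDyn.space.carrier
  heytingAlgebra := X.isEsakia.heytingAlgebra
  nablaAlgebra := X.toGEsakia.nablaAlgebra

/-- The dual Heyting `∇`-algebra morphism of a Heyting generalized Esakia map. -/
def GEsakiaH.Hom.clopUp {X Y : GEsakiaH.{u}} (f : GEsakiaH.Hom X Y) :
    HeytNablaAlg.Hom Y.clopUp X.clopUp where
  toNablaHom := f.toGHom.clopUp
  map_himp := ClopenUpperSet.comap_residual (π := id) (ρ := id) (hf := f.toGHom.hom.continuous)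
    (hm := f.toGHom.hom.monotone) fun x => (f.isEsakiaMap x).symm

theorem GEsakiaH.Hom.exists_clopUp_eq {X Y : GEsakiaH.{u}}
    (h : HeytNablaAlg.Hom Y.clopUp X.clopUp) : ∃ f : GEsakiaH.Hom X Y, f.clopUp = h := by
  obtain ⟨f, hf⟩ := GEsakia.Hom.exists_clopUp_eq (X := X.toGEsakia) (Y := Y.toGEsakia)
    h.toNablaHom
  refine ⟨⟨f, fun x => ?_⟩, HeytNablaAlg.Hom.ext (congrArg (fun k => k.toLatHom) hf)⟩
  refine (preimage_Ici_eq_of_comap_residual (π := id) (ρ := id) continuous_id f.hom.continuous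
    f.hom.monotone X.isEsakia.isClopen_lowerClosure_image_id
    Y.isEsakia.isClopen_lowerClosure_image_id (fun _ => rfl) (fun U V => ?_) x).symm
  have hUV := h.map_himp U V
  rw [← hf] at hUV
  exact hUV

/-- The contravariant functor of clopen upper sets on Heyting generalized Esakia spaces. -/
def GEsakiaH.clopUpFunctor : GEsakiaH.{u}ᵒᵖ ⥤ HeytNablaAlg.{u} where
  obj X := X.unop.clopUp
  map f := GEsakiaH.Hom.clopUp f.unop
  map_id _ := rfl
  map_comp _ _ := rfl

instance : GEsakiaH.clopUpFunctor.{u}.Full where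
  map_surjective h := by
    obtain ⟨f, hf⟩ := GEsakiaH.Hom.exists_clopUp_eq h
    exact ⟨Quiver.Hom.op f, hf⟩

instance : GEsakiaH.clopUpFunctor.{u}.Faithful where
  map_injective h := Quiver.Hom.unop_inj (GEsakiaH.Hom.ext
    (GEsakia.Hom.clopUp_injective (congrArg HeytNablaAlg.Hom.toNablaHom h)))

end ClopUp

/-! ### Faithful and full algebras -/

section Conditions

open Set

namespace NablaAlgebra

variable {A : Type u} [Lattice A] [BoundedOrder A] [NablaAlgebra A]

theorem gc_nabla_box : GaloisConnection (nabla : A → A) box := fun c b => by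
  rw [box, ← nabla_inf_le_iff, inf_top_eq]

theorem box_surjective_iff :
    Function.Surjective (box : A → A) ↔ Function.Injective (nabla : A → A) := by
  constructor
  · intro h
    refine Function.LeftInverse.injective (g := box) fun a => ?_
    obtain ⟨c, rfl⟩ := h a
    exact gc_nabla_box.u_l_u_eq_u c
  · intro h a
    exact ⟨nabla a, h (gc_nabla_box.l_u_l_eq_l a)⟩

/-- The operation `∇` of a normal `∇`-algebra as a bounded lattice homomorphism; it preserves finite
joins because it has the right adjoint `□`. -/
def nablaHom (h : NablaCond.Holds A .N) : BoundedLatticeHom A A where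
  toFun := nabla
  map_sup' _ _ := gc_nabla_box.l_sup
  map_inf' := h.2
  map_top' := h.1
  map_bot' := gc_nabla_box.l_bot

end NablaAlgebra

section

variable {A B : Type u} [Lattice A] [BoundedOrder A] [NablaAlgebra A]
  [Lattice B] [BoundedOrder B] [NablaAlgebra B]

theorem NablaHom.holds_Fa (f : NablaHom A B) (hf : Function.Surjective f.toLatHom)
    (h : NablaCond.Holds A .Fa) : NablaCond.Holds B .Fa := by
  intro b
  obtain ⟨a, rfl⟩ := hf b
  obtain ⟨c, rfl⟩ := h a
  exact ⟨f.toLatHom c, (f.map_nabla c).symm⟩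

theorem NablaHom.holds_Fu (f : NablaHom A B) (hf : Function.Surjective f.toLatHom)
    (h : NablaCond.Holds A .Fu) : NablaCond.Holds B .Fu := by
  intro b
  obtain ⟨a, rfl⟩ := hf b
  obtain ⟨c, rfl⟩ := h a
  refine ⟨f.toLatHom c, ?_⟩
  rw [NablaAlgebra.box, NablaAlgebra.box, f.map_imp, map_top]

end

namespace GEsakia

variable (X : GEsakia.{u})

theorem clopUp_holds_D : NablaCond.Holds X.clopUp.carrier .D := fun _ _ _ =>
  ClopenUpperSet.eq_of_mem_iff fun _ => and_or_left

theorem clopUp_holds_N : NablaCond.Holds X.clopUp.carrier .N := ⟨rfl, fun _ _ => rfl⟩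

/-- If `π` reflects the order and `U` is a clopen upper set, then no point of the closed set `π[U]`
is below a point of the closed set `π[Uᶜ]`, so a clopen upper set separates them. -/
theorem clopUp_holds_Fa_iff :
    NablaCond.Holds X.clopUp.carrier .Fa ↔ GEsakiaCond.Holds X .rm := by
  refine Iff.trans ?_ (Pries.isRegularMono_iff X.toDyn.dyn).symm
  constructor
  · intro h x y hxy
    by_contra hn
    obtain ⟨U, hx, hy⟩ := ClopenUpperSet.exists_of_not_le hn
    obtain ⟨V, rfl⟩ := h U
    exact hy (ClopenUpperSet.upper V hxy hx)
  · intro h (U : ClopenUpperSet X.toDyn.space.carrier)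
    obtain ⟨V, hV, hd⟩ := ClopenUpperSet.exists_separating
      (U.isClopen.isClosed.isCompact.image X.toDyn.dyn.continuous)
      (U.isClopen.compl.isClosed.isCompact.image X.toDyn.dyn.continuous) (by
        rintro _ ⟨x, hx, rfl⟩ _ ⟨y, hy, rfl⟩ hxy
        exact hy (U.upper (h x y hxy) hx))
    refine ⟨V, ClopenUpperSet.eq_of_mem_iff fun x => ⟨fun hx => ?_, fun hx => hV ⟨x, hx, rfl⟩⟩⟩
    by_contra hn
    exact disjoint_left.1 hd hx ⟨x, hn, rfl⟩

theorem clopUp_holds_Fu_iff :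
    NablaCond.Holds X.clopUp.carrier .Fu ↔ GEsakiaCond.Holds X .e := by
  refine (NablaAlgebra.box_surjective_iff (A := X.clopUp.carrier)).trans
    (Iff.trans ?_ (Pries.epi_iff_surjective X.toDyn.dyn).symm)
  constructor
  · intro h y
    by_contra hy
    obtain ⟨U, V, hyUV, hd⟩ := ClopenUpperSet.exists_diff_disjoint
      (isCompact_range X.toDyn.dyn.continuous) hy
    -- `U` and `U ∩ V` have the same preimage but differ at `y`.
    have hUV : U = U ⊓ V := by
      refine h (ClopenUpperSet.eq_of_mem_iff fun x => ⟨fun hx => ⟨hx, ?_⟩, fun hx => hx.1⟩)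
      by_contra hn
      exact disjoint_left.1 hd ⟨hx, hn⟩ ⟨x, rfl⟩
    have hyU : y ∈ U ⊓ V := hUV ▸ hyUV.1
    exact hyUV.2 hyU.2
  · intro h (U : ClopenUpperSet X.toDyn.space.carrier) V hUV
    refine ClopenUpperSet.eq_of_mem_iff fun y => ?_
    obtain ⟨x, rfl⟩ := h y
    exact ClopenUpperSet.mem_congr hUV x

end GEsakia

end Conditions

/-! ### The dual space of a `∇`-algebra -/

section Spec

/-- The inverse of a bijective `∇`-algebra morphism. -/
noncomputable def NablaHom.symm {A B : Type u} [Lattice A] [BoundedOrder A] [NablaAlgebra A]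
    [Lattice B] [BoundedOrder B] [NablaAlgebra B] (f : NablaHom A B)
    (hf : Function.Bijective f.toLatHom) : NablaHom B A where
  toLatHom :=
    { toFun := Function.surjInv hf.2
      map_sup' a b := hf.1 (by simp [Function.surjInv_eq hf.2])
      map_inf' a b := hf.1 (by simp [Function.surjInv_eq hf.2])
      map_top' := hf.1 (by simp [Function.surjInv_eq hf.2])
      map_bot' := hf.1 (by simp [Function.surjInv_eq hf.2]) }
  map_nabla a := hf.1 <| by
    rw [f.map_nabla]
    exact (Function.surjInv_eq hf.2 _).trans
      (congrArg _ (Function.surjInv_eq hf.2 a)).symm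
  map_imp a b := hf.1 <| by
    rw [f.map_imp]
    exact (Function.surjInv_eq hf.2 _).trans
      (congrArg₂ _ (Function.surjInv_eq hf.2 a) (Function.surjInv_eq hf.2 b)).symm

theorem NablaHom.apply_symm {A B : Type u} [Lattice A] [BoundedOrder A] [NablaAlgebra A]
    [Lattice B] [BoundedOrder B] [NablaAlgebra B] (f : NablaHom A B)
    (hf : Function.Bijective f.toLatHom) (b : B) : f.toLatHom ((f.symm hf).toLatHom b) = b :=
  Function.surjInv_eq hf.2 b

theorem NablaHom.symm_apply {A B : Type u} [Lattice A] [BoundedOrder A] [NablaAlgebra A]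
    [Lattice B] [BoundedOrder B] [NablaAlgebra B] (f : NablaHom A B)
    (hf : Function.Bijective f.toLatHom) (a : A) : (f.symm hf).toLatHom (f.toLatHom a) = a :=
  Function.leftInverse_surjInv hf a

/-- A bijective `∇`-algebra morphism is an isomorphism. -/
noncomputable def NablaAlg.isoOfBijective {A B : NablaAlg.{u}}
    (f : NablaHom A.carrier B.carrier) (hf : Function.Bijective f.toLatHom) : A ≅ B where
  hom := f
  inv := f.symm hf
  hom_inv_id := NablaHom.ext (DFunLike.ext _ _ (f.symm_apply hf))
  inv_hom_id := NablaHom.ext (DFunLike.ext _ _ (f.apply_symm hf))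

/-- A bijective Heyting `∇`-algebra morphism is an isomorphism. -/
noncomputable def HeytNablaAlg.isoOfBijective {A B : HeytNablaAlg.{u}}
    (f : HeytNablaAlg.Hom A B) (hf : Function.Bijective f.toLatHom) : A ≅ B where
  hom := f
  inv :=
    { toNablaHom := f.toNablaHom.symm hf
      map_himp := fun a b => hf.1 <| by
        rw [f.map_himp, f.toNablaHom.apply_symm hf, f.toNablaHom.apply_symm hf,
          f.toNablaHom.apply_symm hf] }
  hom_inv_id := HeytNablaAlg.Hom.ext (DFunLike.ext _ _ (f.toNablaHom.symm_apply hf))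
  inv_hom_id := HeytNablaAlg.Hom.ext (DFunLike.ext _ _ (f.toNablaHom.apply_symm hf))

namespace NablaAlg

variable (A : NablaAlg.{u}) (hD : NablaCond.Holds A.carrier .D) (hN : NablaCond.Holds A.carrier .N)

/-- The dual generalized Esakia space of a distributive normal `∇`-algebra: the prime spectrum, with
the inverse image of prime filters under `∇` as dynamism. -/
def spec : GEsakia.{u} where
  toDyn :=
    { space := { carrier := LatticeSpec A.carrier }
      dyn := ⟨LatticeSpec.comap (NablaAlgebra.nablaHom hN), LatticeSpec.continuous_comap _,
        LatticeSpec.monotone_comap _⟩ }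
  isClopen_lowerClosure_image :=
    LatticeSpec.isClopen_lowerClosure_image_comap hD NablaAlgebra.nabla_inf_le_iff

/-- The unit of the duality, as a `∇`-algebra morphism. -/
def unitHom : NablaHom A.carrier (A.spec hD hN).clopUp.carrier where
  toLatHom := LatticeSpec.unit A.carrier
  map_nabla _ := rfl
  map_imp := LatticeSpec.unit_residual (j := NablaAlgebra.nablaHom hN) hD
    NablaAlgebra.nabla_inf_le_iff (A.spec hD hN).isClopen_lowerClosure_image

theorem unitHom_bijective : Function.Bijective (A.unitHom hD hN).toLatHom :=
  ⟨LatticeSpec.unit_injective hD, LatticeSpec.unit_surjective⟩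

end NablaAlg

namespace HeytNablaAlg

/-- The `∇`-algebra reduct of an explicitly Heyting `∇`-algebra. -/
abbrev toNablaAlg (A : HeytNablaAlg.{u}) : NablaAlg.{u} where
  carrier := A.carrier

variable (A : HeytNablaAlg.{u}) (hD : NablaCond.Holds A.carrier .D)
  (hN : NablaCond.Holds A.carrier .N)

/-- The dual space of an explicitly Heyting `∇`-algebra. -/
def spec : GEsakiaH.{u} where
  toGEsakia := A.toNablaAlg.spec hD hN
  isEsakia (W : Set (LatticeSpec A.carrier)) hW := by
    have h := LatticeSpec.isClopen_lowerClosure_image_comap (A := A.carrier)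
      (j := BoundedLatticeHom.id A.carrier) (r := (· ⇨ ·)) hD
      (fun a b c => (le_himp_iff (a := c) (b := a) (c := b)).symm) W hW
    have hid : LatticeSpec.comap (BoundedLatticeHom.id A.carrier) = id := rfl
    rwa [hid, Set.image_id (α := LatticeSpec A.carrier)] at h

/-- The unit of the duality, as a Heyting `∇`-algebra morphism. -/
def unitHom : HeytNablaAlg.Hom A (A.spec hD hN).clopUp where
  toNablaHom := A.toNablaAlg.unitHom hD hN
  map_himp := LatticeSpec.unit_residual (A := A.carrier)
    (j := BoundedLatticeHom.id A.carrier) (r := (· ⇨ ·)) hD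
    (fun a b c => (le_himp_iff (a := c) (b := a) (c := b)).symm)
    (A.spec hD hN).isEsakia.isClopen_lowerClosure_image_id

end HeytNablaAlg

end Spec

/-! ### Reversible dynamic Esakia spaces -/

section Reversible

open Set

theorem Esakia.exists_inverse {X : Esakia.{u}} (f : X ⟶ X) [IsIso f] :
    ∃ g : X ⟶ X, (∀ x, g.hom.toFun (f.hom.toFun x) = x) ∧ ∀ x, f.hom.toFun (g.hom.toFun x) = x :=
  ⟨inv f, congrFun (congrArg (fun k : X ⟶ X => k.hom.toFun) (IsIso.hom_inv_id f)),
    congrFun (congrArg (fun k : X ⟶ X => k.hom.toFun) (IsIso.inv_hom_id f))⟩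

/-- A reversible dynamic Esakia space is a Heyting generalized Esakia space. -/
def RevDynObj.toGEsakiaH (X : RevDynObj Esakia.{u}) : GEsakiaH.{u} where
  toGEsakia :=
    { toDyn := ⟨X.obj.space.toPries, X.obj.dyn.hom⟩
      isClopen_lowerClosure_image := fun U hU => by
        have := X.property
        obtain ⟨g, hg, hg'⟩ := Esakia.exists_inverse X.obj.dyn
        rw [image_eq_preimage_of_inverse hg hg']
        exact X.obj.space.isEsakia _ (hU.preimage g.hom.continuous) }
  isEsakia := X.obj.space.isEsakia

/-- For an invertible dynamism, the condition on generalized Esakia maps follows from the one on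
Esakia maps and equivariance. -/
def RevDynObj.toGEsakiaHHom {X Y : RevDynObj Esakia.{u}} (f : X ⟶ Y) :
    GEsakiaH.Hom (RevDynObj.toGEsakiaH X) (RevDynObj.toGEsakiaH Y) where
  toGHom :=
    { hom := f.hom.hom.hom
      comm := congrArg Esakia.Hom.hom f.hom.comm
      preimage_Ici := fun x => by
        have hcomm (z : X.obj.space.toPries.carrier) :
            f.hom.hom.hom.toFun (X.obj.dyn.hom.toFun z) =
              Y.obj.dyn.hom.toFun (f.hom.hom.hom.toFun z) :=
          congrFun (congrArg (fun k : X.obj.space ⟶ Y.obj.space => k.hom.toFun) f.hom.comm) z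
        have := X.property
        have := Y.property
        obtain ⟨g, hg, hg'⟩ := Esakia.exists_inverse X.obj.dyn
        obtain ⟨k, hk, -⟩ := Esakia.exists_inverse Y.obj.dyn
        apply Subset.antisymm
        · intro y (hy : f.hom.hom.hom.toFun x ≤ Y.obj.dyn.hom.toFun y)
          obtain ⟨z, hz, hzy⟩ : Y.obj.dyn.hom.toFun y ∈ f.hom.hom.hom.toFun '' Ici x := by
            rw [f.hom.hom.isEsakiaMap x]
            exact hy
          refine ⟨g.hom.toFun z, (hz.trans (hg' z).ge : x ≤ X.obj.dyn.hom.toFun _), ?_⟩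
          apply Function.LeftInverse.injective hk
          rw [← hzy, ← hcomm, hg']
        · rintro _ ⟨z, hz, rfl⟩
          exact (f.hom.hom.hom.monotone hz).trans (hcomm z).le }
  isEsakiaMap := f.hom.hom.isEsakiaMap

/-- The full embedding of reversible dynamic Esakia spaces into Heyting generalized Esakia
spaces. -/
def RevDynObj.toGEsakiaHFunctor : RevDynObj Esakia.{u} ⥤ GEsakiaH.{u} where
  obj := RevDynObj.toGEsakiaH
  map := RevDynObj.toGEsakiaHHom

instance : RevDynObj.toGEsakiaHFunctor.{u}.Full where
  map_surjective f :=
    ⟨ObjectProperty.homMk ⟨⟨f.toGHom.hom, f.isEsakiaMap⟩, Esakia.Hom.ext f.toGHom.comm⟩, rfl⟩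

instance : RevDynObj.toGEsakiaHFunctor.{u}.Faithful where
  map_injective {X Y f g} h := by
    have h' : f.hom.hom.hom = g.hom.hom.hom :=
      congrArg (fun k : GEsakiaH.Hom _ _ => k.toGHom.hom) h
    exact ObjectProperty.hom_ext _ (DynObj.Hom.ext (Esakia.Hom.ext h'))

theorem RevDynObj.toGEsakiaH_holds (X : RevDynObj Esakia.{u}) (c : GEsakiaCond) :
    GEsakiaCond.Holds (RevDynObj.toGEsakiaH X).toGEsakia c := by
  have := X.property
  obtain ⟨g, hg, hg'⟩ := Esakia.exists_inverse X.obj.dyn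
  cases c with
  | rm =>
    refine (Pries.isRegularMono_iff _).2 fun x y hxy => ?_
    rw [← hg x, ← hg y]
    exact g.hom.monotone hxy
  | e => exact (Pries.epi_iff_surjective _).2 (Function.RightInverse.surjective hg')

theorem Pries.Hom.isEsakiaMap_of_surjective {X Y : Pries.{u}} {f : X ⟶ Y}
    (hf : ∀ x y, f.toFun x ≤ f.toFun y → x ≤ y) (hs : Function.Surjective f.toFun) :
    Pries.Hom.IsEsakiaMap f := by
  intro x
  apply Subset.antisymm
  · rintro _ ⟨z, hz, rfl⟩
    exact f.monotone hz
  · intro y hy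
    obtain ⟨z, rfl⟩ := hs y
    exact ⟨z, hf x z hy, rfl⟩

theorem RevDynObj.exists_toGEsakiaH_eq (X : GEsakiaH.{u})
    (hrm : GEsakiaCond.Holds X.toGEsakia .rm) (he : GEsakiaCond.Holds X.toGEsakia .e) :
    ∃ R, RevDynObj.toGEsakiaH R = X := by
  have hf := (Pries.isRegularMono_iff _).1 hrm
  have hs := (Pries.epi_iff_surjective _).1 he
  have hinj : Function.Injective X.toGEsakia.toDyn.dyn.toFun := fun a b hab =>
    (hf a b hab.le).antisymm (hf b a hab.ge)
  let S : Esakia.{u} := ⟨X.toGEsakia.toDyn.space, X.isEsakia⟩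
  let π : S ⟶ S := ⟨X.toGEsakia.toDyn.dyn, Pries.Hom.isEsakiaMap_of_surjective hf hs⟩
  have hr := Function.surjInv_eq hs
  have hl := Function.leftInverse_surjInv ⟨hinj, hs⟩
  -- A continuous bijection of compact Hausdorff spaces has a continuous inverse.
  let g : X.toGEsakia.toDyn.space ⟶ X.toGEsakia.toDyn.space :=
    ⟨Function.surjInv hs, by
      rw [(X.toGEsakia.toDyn.dyn.continuous.isClosedEmbedding hinj).isInducing.continuous_iff,
        show X.toGEsakia.toDyn.dyn.toFun ∘ Function.surjInv hs = id from funext hr]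
      exact continuous_id,
    fun a b hab => hf _ _ (by rwa [hr, hr])⟩
  have hgE : Pries.Hom.IsEsakiaMap g := by
    refine Pries.Hom.isEsakiaMap_of_surjective (fun x y hxy => ?_) hl.surjective
    have h := X.toGEsakia.toDyn.dyn.monotone hxy
    rwa [hr, hr] at h
  have hiso : IsIso π := ⟨⟨⟨g, hgE⟩, Esakia.Hom.ext (Pries.hom_ext hl),
    Esakia.Hom.ext (Pries.hom_ext hr)⟩⟩
  exact ⟨⟨⟨S, π⟩, hiso⟩, rfl⟩

end Reversible

/-! ### The duality theorem -/

/-- A fully faithful functor whose essential image is the class of objects with property `P` restricts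
to an equivalence with the full subcategory of those objects. -/
theorem nonempty_fullSubcategory_equivalence {𝒮 𝒟 : Type*} [Category 𝒮] [Category 𝒟] (G : 𝒮 ⥤ 𝒟)
    [G.Full] [G.Faithful] (P : ObjectProperty 𝒟) (hP : ∀ X, P (G.obj X))
    (hG : ∀ A, P A → ∃ X, Nonempty (G.obj X ≅ A)) : Nonempty (P.FullSubcategory ≌ 𝒮) := by
  have : (P.lift G hP).EssSurj := ⟨fun A => by
    obtain ⟨X, ⟨e⟩⟩ := hG A.obj A.property
    exact ⟨X, ⟨P.isoMk e⟩⟩⟩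
  have : (P.lift G hP).IsEquivalence := {}
  exact ⟨(P.lift G hP).asEquivalence.symm⟩

theorem mainTheorem2 :
    (Nonempty (AlgNabla.{u} {.D, .N} ≌ GEsakia.{u}ᵒᵖ) ∧
      Nonempty (AlgNablaH.{u} {.D, .N} ≌ GEsakiaH.{u}ᵒᵖ)) ∧
    (Nonempty (AlgNabla.{u} {.D, .N, .Fa} ≌ (GEsakiaSub.{u} {.rm})ᵒᵖ) ∧
      Nonempty (AlgNablaH.{u} {.D, .N, .Fa} ≌ (GEsakiaHSub.{u} {.rm})ᵒᵖ)) ∧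
    (Nonempty (AlgNabla.{u} {.D, .N, .Fu} ≌ (GEsakiaSub.{u} {.e})ᵒᵖ) ∧
      Nonempty (AlgNablaH.{u} {.D, .N, .Fu} ≌ (GEsakiaHSub.{u} {.e})ᵒᵖ)) ∧
    Nonempty (AlgNablaH.{u} {.D, .N, .Fa, .Fu} ≌ (RevDynObj Esakia.{u})ᵒᵖ) := by
  -- The dual space of an algebra inherits the conditions of the algebra along the unit.
  have hFa (A : NablaAlg.{u}) (hD hN) (h : NablaCond.Holds A.carrier .Fa) :
      GEsakiaCond.Holds (A.spec hD hN) .rm := (GEsakia.clopUp_holds_Fa_iff _).1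
    ((A.unitHom hD hN).holds_Fa (A.unitHom_bijective hD hN).2 h)
  have hFu (A : NablaAlg.{u}) (hD hN) (h : NablaCond.Holds A.carrier .Fu) :
      GEsakiaCond.Holds (A.spec hD hN) .e := (GEsakia.clopUp_holds_Fu_iff _).1
    ((A.unitHom hD hN).holds_Fu (A.unitHom_bijective hD hN).2 h)
  have iso (A : NablaAlg.{u}) (hD hN) : Nonempty ((A.spec hD hN).clopUp ≅ A) :=
    ⟨(NablaAlg.isoOfBijective _ (A.unitHom_bijective hD hN)).symm⟩
  have isoH (A : HeytNablaAlg.{u}) (hD hN) : Nonempty ((A.spec hD hN).clopUp ≅ A) :=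
    ⟨(HeytNablaAlg.isoOfBijective (A.unitHom hD hN)
      (A.toNablaAlg.unitHom_bijective hD hN)).symm⟩
  refine ⟨⟨?_, ?_⟩, ⟨?_, ?_⟩, ⟨?_, ?_⟩, ?_⟩
  · refine nonempty_fullSubcategory_equivalence GEsakia.clopUpFunctor _ ?_ ?_
    · rintro X c (rfl | rfl)
      exacts [X.unop.clopUp_holds_D, X.unop.clopUp_holds_N]
    · intro A hA
      have hD := hA .D (by simp)
      have hN := hA .N (by simp)
      exact ⟨.op (A.spec hD hN), iso A hD hN⟩
  · refine nonempty_fullSubcategory_equivalence GEsakiaH.clopUpFunctor _ ?_ ?_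
    · rintro X c (rfl | rfl)
      exacts [X.unop.toGEsakia.clopUp_holds_D, X.unop.toGEsakia.clopUp_holds_N]
    · intro A hA
      have hD := hA .D (by simp)
      have hN := hA .N (by simp)
      exact ⟨.op (A.spec hD hN), isoH A hD hN⟩
  · refine nonempty_fullSubcategory_equivalence
      ((ObjectProperty.ι _).op ⋙ GEsakia.clopUpFunctor) _ ?_ ?_
    · rintro X c (rfl | rfl | rfl)
      exacts [X.unop.obj.clopUp_holds_D, X.unop.obj.clopUp_holds_N,
        X.unop.obj.clopUp_holds_Fa_iff.2 (X.unop.property _ rfl)]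
    · intro A hA
      have hD := hA .D (by simp)
      have hN := hA .N (by simp)
      refine ⟨.op ⟨A.spec hD hN, ?_⟩, iso A hD hN⟩
      rintro _ rfl
      exact hFa A hD hN (hA .Fa (by simp))
  · refine nonempty_fullSubcategory_equivalence
      ((ObjectProperty.ι _).op ⋙ GEsakiaH.clopUpFunctor) _ ?_ ?_
    · rintro X c (rfl | rfl | rfl)
      exacts [X.unop.obj.toGEsakia.clopUp_holds_D, X.unop.obj.toGEsakia.clopUp_holds_N,
        X.unop.obj.toGEsakia.clopUp_holds_Fa_iff.2 (X.unop.property _ rfl)]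
    · intro A hA
      have hD := hA .D (by simp)
      have hN := hA .N (by simp)
      refine ⟨.op ⟨A.spec hD hN, ?_⟩, isoH A hD hN⟩
      rintro _ rfl
      exact hFa A.toNablaAlg hD hN (hA .Fa (by simp))
  · refine nonempty_fullSubcategory_equivalence
      ((ObjectProperty.ι _).op ⋙ GEsakia.clopUpFunctor) _ ?_ ?_
    · rintro X c (rfl | rfl | rfl)
      exacts [X.unop.obj.clopUp_holds_D, X.unop.obj.clopUp_holds_N,
        X.unop.obj.clopUp_holds_Fu_iff.2 (X.unop.property _ rfl)]
    · intro A hA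
      have hD := hA .D (by simp)
      have hN := hA .N (by simp)
      refine ⟨.op ⟨A.spec hD hN, ?_⟩, iso A hD hN⟩
      rintro _ rfl
      exact hFu A hD hN (hA .Fu (by simp))
  · refine nonempty_fullSubcategory_equivalence
      ((ObjectProperty.ι _).op ⋙ GEsakiaH.clopUpFunctor) _ ?_ ?_
    · rintro X c (rfl | rfl | rfl)
      exacts [X.unop.obj.toGEsakia.clopUp_holds_D, X.unop.obj.toGEsakia.clopUp_holds_N,
        X.unop.obj.toGEsakia.clopUp_holds_Fu_iff.2 (X.unop.property _ rfl)]
    · intro A hA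
      have hD := hA .D (by simp)
      have hN := hA .N (by simp)
      refine ⟨.op ⟨A.spec hD hN, ?_⟩, isoH A hD hN⟩
      rintro _ rfl
      exact hFu A.toNablaAlg hD hN (hA .Fu (by simp))
  · refine nonempty_fullSubcategory_equivalence
      (RevDynObj.toGEsakiaHFunctor.op ⋙ GEsakiaH.clopUpFunctor) _ ?_ ?_
    · intro X
      let Y := (RevDynObj.toGEsakiaH X.unop).toGEsakia
      rintro c (rfl | rfl | rfl | rfl)
      exacts [Y.clopUp_holds_D, Y.clopUp_holds_N,
        Y.clopUp_holds_Fa_iff.2 (RevDynObj.toGEsakiaH_holds _ _),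
        Y.clopUp_holds_Fu_iff.2 (RevDynObj.toGEsakiaH_holds _ _)]
    · intro A hA
      have hD := hA .D (by simp)
      have hN := hA .N (by simp)
      obtain ⟨R, hR⟩ := RevDynObj.exists_toGEsakiaH_eq
        (A.spec hD hN) (hFa A.toNablaAlg hD hN (hA .Fa (by simp)))
        (hFu A.toNablaAlg hD hN (hA .Fu (by simp)))
      obtain ⟨e⟩ := isoH A hD hN
      exact ⟨.op R, ⟨eqToIso (congrArg GEsakiaH.clopUp hR) ≪≫ e⟩⟩
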